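/- Let $\mathbb O=\mathbb H\oplus\mathbb H$ be the octonions, with multiplication $(q_1,q_2)(p_1,p_2)=(q_1p_1-\bar p_2q_2,\;p_2q_1+q_2\bar p_1)$, conjugation $\overline{(q_1,q_2)}=(\bar q_1,-q_2)$, inner product $\langle a,b\rangle=\mathrm{Re}(a\bar b)$ and norm $|a|^2=\langle a,a\rangle$. The octonionic hyperbolic plane is the open unit ball $\mathbb OH^2=\{(u,v)\in\mathbb O^2 : |u|^2+|v|^2<1\}$ with the metric $$ds^2=\frac{|du|^2(1-|v|^2)+|dv|^2(1-|u|^2)+2\,\mathrm{Re}[(u\bar v)(dv\,d\bar u)]}{(1-|u|^2-|v|^2)^2}.$$ The octonionic projective plane $\mathbb OP^2$ is the quotient of the set of those triples in $\mathbb O^3$ that have at least one entry equal to $1$ by the equivalence relation $[a,b,c]\sim[d,e,f]\iff a=d\lambda,\ b=e\lambda,\ c=f\lambda$ for some $\lambda\in\mathbb O\setminus\{0\}$, with the smooth structure given by the three affine charts $[1,u,v]\mapsto(u,v)$, $[u,1,v]\mapsto(u,v)$, $[u,v,1]\mapsto(u,v)$, and with the metric that in each of these charts is $$ds^2=\frac{|du|^2(1+|v|^2)+|dv|^2(1+|u|^2)-2\,\mathrm{Re}[(u\bar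 v)(dv\,d\bar u)]}{(1+|u|^2+|v|^2)^2}.$$ The Riemann curvature tensor is taken with the sign convention $R_{\alpha\beta\gamma}{}^{\delta}=\partial_\beta\Gamma_{\alpha\gamma}^\delta-\partial_\alpha\Gamma_{\beta\gamma}^\delta+\Gamma_{\beta\epsilon}^\delta\Gamma_{\alpha\gamma}^\epsilon-\Gamma_{\alpha\epsilon}^\delta\Gamma_{\beta\gamma}^\epsilon$ and $R_{\alpha\beta\gamma\delta}=g_{\delta\epsilon}R_{\alpha\beta\gamma}{}^{\epsilon}$, and the tangent spaces of $\mathbb OH^2$ at $P_0=(0,0)$ and of $\mathbb OP^2$ at $[1,0,0]$ are identified with $\mathbb O^2$ by the coordinates $(u,v)$. Theorem. $\mathbb OH^2$ is a $16$-dimensional, simply connected, smooth Riemannian manifold (in particular, the metric above is smooth and positive definite), and it is homogeneous: its isometries act transitively. Its Riemann curvature tensor at $P_0$ is the negative of the Riemann curvature tensor of $\mathbb OP^2$ at $[1,0,0]$, that is, it is $-R$ with $$\begin{aligned}R\big((a,b),(c,d),(e,f),(g,h)\big)={}&4\langle a,e\rangle\langle c,g\rangle-4\langle c,e\rangle\langle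 a,g\rangle+4\langle b,f\rangle\langle d,h\rangle-4\langle d,f\rangle\langle b,h\rangle\\&-\langle e\bar d,g\bar b\rangle+\langle e\bar b,g\bar d\rangle-\langle c\bar f,a\bar h\rangle+\langle a\bar f,c\bar h\rangle-\langle a\bar d-c\bar b,\;g\bar f-e\bar h\rangle.\end{aligned}$$ -/

import Mathlib

open scoped Manifold ContDiff Topology

noncomputable section

/-- The octonions `𝕆 = ℍ ⊕ ℍ`, with the Euclidean norm of `ℝ⁸`. -/
def Octonion : Type := WithLp 2 (Quaternion ℝ × Quaternion ℝ)

namespace Octonion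

instance : NormedAddCommGroup Octonion :=
  inferInstanceAs (NormedAddCommGroup (WithLp 2 (Quaternion ℝ × Quaternion ℝ)))

instance : InnerProductSpace ℝ Octonion :=
  inferInstanceAs (InnerProductSpace ℝ (WithLp 2 (Quaternion ℝ × Quaternion ℝ)))

instance : FiniteDimensional ℝ Octonion :=
  inferInstanceAs (FiniteDimensional ℝ (WithLp 2 (Quaternion ℝ × Quaternion ℝ)))

/-- The octonion `(q₁, q₂)`. -/
def mk (q₁ q₂ : Quaternion ℝ) : Octonion := WithLp.toLp 2 (q₁, q₂)

/-- The first quaternion component. -/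
def fst (a : Octonion) : Quaternion ℝ := WithLp.fst a

/-- The second quaternion component. -/
def snd (a : Octonion) : Quaternion ℝ := WithLp.snd a

/-- The real part. -/
def re (a : Octonion) : ℝ := a.fst.re

/-- Cayley–Dickson multiplication
`(q₁, q₂) * (p₁, p₂) = (q₁ p₁ - p̄₂ q₂, p₂ q₁ + q₂ p̄₁)`. -/
instance : Mul Octonion :=
  ⟨fun a b => mk (a.fst * b.fst - star b.snd * a.snd) (b.snd * a.fst + a.snd * star b.fst)⟩

instance : One Octonion := ⟨mk 1 0⟩

/-- Octonionic conjugation `(q₁, q₂) ↦ (q̄₁, -q₂)`. -/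
instance : Star Octonion := ⟨fun a => mk (star a.fst) (-a.snd)⟩

/-- The inverse `a⁻¹ = |a|⁻² ā` (and `0⁻¹ = 0`). -/
instance : Inv Octonion := ⟨fun a => (‖a‖ ^ 2)⁻¹ • star a⟩

@[ext] theorem ext {a b : Octonion} (h₁ : a.fst = b.fst) (h₂ : a.snd = b.snd) : a = b :=
  WithLp.ofLp_injective 2 (Prod.ext h₁ h₂)

@[simp] theorem fst_mk (p q : Quaternion ℝ) : (mk p q).fst = p := rfl
@[simp] theorem snd_mk (p q : Quaternion ℝ) : (mk p q).snd = q := rfl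
@[simp] theorem fst_zero : (0 : Octonion).fst = 0 := rfl
@[simp] theorem snd_zero : (0 : Octonion).snd = 0 := rfl
@[simp] theorem fst_one : (1 : Octonion).fst = 1 := rfl
@[simp] theorem snd_one : (1 : Octonion).snd = 0 := rfl
@[simp] theorem fst_add (a b : Octonion) : (a + b).fst = a.fst + b.fst := rfl
@[simp] theorem snd_add (a b : Octonion) : (a + b).snd = a.snd + b.snd := rfl
@[simp] theorem fst_smul (r : ℝ) (a : Octonion) : (r • a).fst = r • a.fst := rfl
@[simp] theorem snd_smul (r : ℝ) (a : Octonion) : (r • a).snd = r • a.snd := rfl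
@[simp] theorem fst_star (a : Octonion) : (star a).fst = star a.fst := rfl
@[simp] theorem snd_star (a : Octonion) : (star a).snd = -a.snd := rfl
@[simp] theorem fst_mul (a b : Octonion) :
    (a * b).fst = a.fst * b.fst - star b.snd * a.snd := rfl
@[simp] theorem snd_mul (a b : Octonion) :
    (a * b).snd = b.snd * a.fst + a.snd * star b.fst := rfl

instance : NonAssocRing Octonion :=
  { (inferInstance : AddCommGroup Octonion), (inferInstance : Mul Octonion),
    (inferInstance : One Octonion) with
    left_distrib := fun a b c => by
      ext1 <;> simp only [fst_mul, snd_mul, fst_add, snd_add, star_add, mul_add, add_mul] <;> abel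
    right_distrib := fun a b c => by
      ext1 <;> simp only [fst_mul, snd_mul, fst_add, snd_add, mul_add, add_mul] <;> abel
    zero_mul := fun a => by ext1 <;> simp
    mul_zero := fun a => by ext1 <;> simp
    one_mul := fun a => by ext1 <;> simp
    mul_one := fun a => by ext1 <;> simp }

instance : IsScalarTower ℝ Octonion Octonion :=
  ⟨fun r a b => by ext1 <;> simp [smul_sub, smul_add]⟩

instance : SMulCommClass ℝ Octonion Octonion :=
  ⟨fun r a b => by ext1 <;> simp [smul_sub, smul_add]⟩

theorem re_add (a b : Octonion) : (a + b).re = a.re + b.re := rfl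

theorem re_neg (a : Octonion) : (-a).re = -a.re := rfl

theorem re_smul (r : ℝ) (a : Octonion) : (r • a).re = r * a.re := rfl

theorem star_add' (a b : Octonion) : star (a + b) = star a + star b := by
  ext1 <;> simp [add_comm]

theorem star_smul' (r : ℝ) (a : Octonion) : star (r • a) = r • star a := by
  ext1 <;> simp

/-- The inner product is `⟨a, b⟩ = Re[a b̄]`. -/
theorem inner_eq_re (a b : Octonion) : inner ℝ a b = (a * star b).re := by
  have h : inner ℝ a b = inner ℝ a.fst b.fst + inner ℝ a.snd b.snd := rfl
  rw [h]
  simp only [re, fst_mul, fst_star, snd_star, Quaternion.inner_def]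
  simp
  ring

theorem norm_sq_eq (a : Octonion) : ‖a‖ ^ 2 =
    a.fst.re ^ 2 + a.fst.imI ^ 2 + a.fst.imJ ^ 2 + a.fst.imK ^ 2 +
      (a.snd.re ^ 2 + a.snd.imI ^ 2 + a.snd.imJ ^ 2 + a.snd.imK ^ 2) := by
  rw [← real_inner_self_eq_norm_sq, inner_eq_re]
  simp [re]
  ring

theorem mul_mul_star (a b : Octonion) : a * b * star b = (‖b‖ ^ 2) • a := by
  rw [norm_sq_eq]
  ext <;> simp <;> ring

theorem star_mul_mul (a b : Octonion) : star a * (a * b) = (‖a‖ ^ 2) • b := by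
  rw [norm_sq_eq]
  ext <;> simp <;> ring

theorem star_star' (a : Octonion) : star (star a) = a := by ext1 <;> simp

theorem norm_star' (a : Octonion) : ‖star a‖ ^ 2 = ‖a‖ ^ 2 := by
  rw [norm_sq_eq, norm_sq_eq]; simp

theorem mul_mul_inv {b : Octonion} (a : Octonion) (hb : b ≠ 0) : a * b * b⁻¹ = a := by
  have : ‖b‖ ^ 2 ≠ 0 := by simpa using hb
  change a * b * ((‖b‖ ^ 2)⁻¹ • star b) = a
  rw [mul_smul_comm, mul_mul_star, smul_smul, inv_mul_cancel₀ this, one_smul]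

theorem mul_inv_mul {b : Octonion} (a : Octonion) (hb : b ≠ 0) : a * b⁻¹ * b = a := by
  have : ‖b‖ ^ 2 ≠ 0 := by simpa using hb
  have h := mul_mul_star a (star b)
  rw [star_star', norm_star'] at h
  change a * ((‖b‖ ^ 2)⁻¹ • star b) * b = a
  rw [mul_smul_comm, smul_mul_assoc, h, smul_smul, inv_mul_cancel₀ this, one_smul]

theorem inv_mul_mul {a : Octonion} (b : Octonion) (ha : a ≠ 0) : a⁻¹ * (a * b) = b := by
  have : ‖a‖ ^ 2 ≠ 0 := by simpa using ha
  change (((‖a‖ ^ 2)⁻¹ • star a) : Octonion) * (a * b) = b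
  rw [smul_mul_assoc, star_mul_mul, smul_smul, inv_mul_cancel₀ this, one_smul]

theorem mul_inv_self {a : Octonion} (ha : a ≠ 0) : a * a⁻¹ = 1 := by
  simpa using mul_mul_inv 1 ha

theorem inv_mul_self {a : Octonion} (ha : a ≠ 0) : a⁻¹ * a = 1 := by
  simpa using mul_inv_mul 1 ha

instance : Nontrivial Octonion := ⟨⟨0, 1, fun h => by simpa using congrArg fst h⟩⟩

theorem inv_ne_zero' {a : Octonion} (ha : a ≠ 0) : a⁻¹ ≠ 0 := fun h => by
  have := mul_inv_self ha
  rw [h, mul_zero] at this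
  exact zero_ne_one this

theorem norm_mul_sq (a b : Octonion) : ‖a * b‖ ^ 2 = ‖a‖ ^ 2 * ‖b‖ ^ 2 := by
  rw [norm_sq_eq, norm_sq_eq, norm_sq_eq]; simp; ring

theorem mul_ne_zero' {a b : Octonion} (ha : a ≠ 0) (hb : b ≠ 0) : a * b ≠ 0 := fun h => by
  have := norm_mul_sq a b
  rw [h] at this
  simp [ha, hb] at this

theorem star_mul' (a b : Octonion) : star (a * b) = star b * star a := by
  ext1 <;> simp [neg_mul, mul_neg, add_comm]

theorem mul_inv_rev' (a b : Octonion) : (a * b)⁻¹ = b⁻¹ * a⁻¹ := by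
  change (‖a * b‖ ^ 2)⁻¹ • star (a * b) = ((‖b‖ ^ 2)⁻¹ • star b) * ((‖a‖ ^ 2)⁻¹ • star a)
  rw [norm_mul_sq, star_mul', smul_mul_assoc, mul_smul_comm, smul_smul, mul_inv_rev]

theorem contDiff_mul : ContDiff ℝ ∞ (fun p : Octonion × Octonion => p.1 * p.2) :=
  ((LinearMap.mul ℝ Octonion).toContinuousBilinearMap).isBoundedBilinearMap.contDiff

theorem contDiffOn_inv : ContDiffOn ℝ ∞ (fun a : Octonion => a⁻¹) {a | a ≠ 0} := by
  have hs : ContDiff ℝ ∞ (fun a : Octonion => star a) :=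
    (LinearMap.toContinuousLinearMap
      ({ toFun := fun a => star a
         map_add' := star_add'
         map_smul' := star_smul' } : Octonion →ₗ[ℝ] Octonion)).contDiff
  have hn : ContDiff ℝ ∞ (fun a : Octonion => ‖a‖ ^ 2) := contDiff_norm_sq ℝ
  exact (hn.contDiffOn.inv fun a ha => by simpa using ha).smul hs.contDiffOn

end Octonion

/-- The plane `𝕆²`, the model space of all manifolds below. -/
abbrev OctPlane : Type := Octonion × Octonion

namespace OP2

/-- `[a] ∼ [b]` on `𝕆³`: there is `l ≠ 0` with `aₖ = bₖ l` for `k = 1, 2, 3`. -/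
def Proportional (a b : Fin 3 → Octonion) : Prop :=
  ∃ l : Octonion, l ≠ 0 ∧ ∀ k, a k = b k * l

/-- `𝒰 = U₁ ∪ U₂ ∪ U₃`: triples of octonions at least one of which is `1`. -/
def Reduced : Set (Fin 3 → Octonion) := {a | ∃ i, a i = 1}

theorem proportional_trans {a b c : Fin 3 → Octonion} (ha : a ∈ Reduced) (hb : b ∈ Reduced)
    (hc : c ∈ Reduced) (hab : Proportional a b) (hbc : Proportional b c) :
    Proportional a c := by
  obtain ⟨l, hl, hab⟩ := hab
  obtain ⟨m, hm, hbc⟩ := hbc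
  obtain ⟨i, hi⟩ := hc
  obtain ⟨k, hk⟩ := hb
  obtain ⟨n, hn⟩ := ha
  refine ⟨m * l, Octonion.mul_ne_zero' hm hl, ?_⟩
  have hck : c k * m = 1 := by rw [← hbc, hk]
  have hbn : b n * l = 1 := by rw [← hab, hn]
  have hckinv : c k = m⁻¹ := by
    rw [← Octonion.mul_mul_inv (c k) hm, hck, one_mul]
  have hbninv : b n = l⁻¹ := by
    rw [← Octonion.mul_mul_inv (b n) hl, hbn, one_mul]
  intro j
  rw [hab, hbc]
  by_cases hki : k = i
  · have : m = 1 := by rw [hki, hi, one_mul] at hck; exact hck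
    simp [this]
  by_cases hnk : n = k
  · have : l = 1 := by rw [hnk, hk, one_mul] at hbn; exact hbn
    simp [this]
  by_cases hni : n = i
  · have hml : m * l = 1 := by
      rw [hbc, hni, hi, one_mul] at hbn; exact hbn
    have hlm : l = m⁻¹ := by
      rw [← Octonion.inv_mul_mul l hm, hml, mul_one]
    rw [hml, hlm, Octonion.mul_mul_inv _ hm, mul_one]
  have hj : j = i ∨ j = k ∨ j = n := by omega
  rcases hj with rfl | rfl | rfl
  · rw [hi, one_mul, one_mul]
  · rw [hck, hckinv, Octonion.inv_mul_mul _ hm, one_mul]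
  · have h1 : c j = l⁻¹ * m⁻¹ := by
      rw [← Octonion.mul_mul_inv (c j) hm, ← hbc, hbninv]
    have h2 : (l⁻¹ * m⁻¹) * (m * l) = 1 := by
      have hml := Octonion.mul_ne_zero' hm hl
      rw [← Octonion.mul_inv_rev' m l, Octonion.inv_mul_self hml]
    rw [← hbc, hbn, h1, h2]

/-- The relation `∼` on `𝒰` is an equivalence relation. -/
instance setoid : Setoid Reduced where
  r a b := Proportional a b
  iseqv :=
    { refl := fun a => ⟨1, one_ne_zero, fun k => (mul_one _).symm⟩
      symm := fun {a b} ⟨l, hl, h⟩ => ⟨l⁻¹, Octonion.inv_ne_zero' hl, fun k => by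
        rw [h, Octonion.mul_mul_inv _ hl]⟩
      trans := fun {a b c} h₁ h₂ => proportional_trans a.2 b.2 c.2 h₁ h₂ }

end OP2

/-- The octonionic projective plane `𝕆P² = 𝒰/∼` in reduced homogeneous coordinates. -/
def OP2 : Type := Quotient OP2.setoid

namespace OP2

/-- The triple with `1` in position `i` and the two remaining entries `u, v` in this order. -/
def triple (i : Fin 3) (x : OctPlane) : Fin 3 → Octonion := i.insertNth 1 ![x.1, x.2]

/-- The two entries of a triple that are not in position `i`. -/
def coords (i : Fin 3) (a : Fin 3 → Octonion) : OctPlane := (a (i.succAbove 0), a (i.succAbove 1))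

theorem triple_self (i : Fin 3) (x : OctPlane) : triple i x i = 1 := by simp [triple]

theorem coords_triple (i : Fin 3) (x : OctPlane) : coords i (triple i x) = x := by
  simp [coords, triple]

theorem triple_coords (i : Fin 3) (a : Fin 3 → Octonion) (h : a i = 1) :
    triple i (coords i a) = a := by
  unfold triple coords
  rw [← Fin.insertNth_self_removeNth i a, h]
  congr 1
  ext1 k
  fin_cases k <;> simp [Fin.removeNth]

/-- The inverse of the affine chart `φᵢ`: `(u, v) ↦ [1, u, v]`, `[u, 1, v]`, `[u, v, 1]` for the
three values of `i`. -/
def param (i : Fin 3) (x : OctPlane) : OP2 :=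
  Quotient.mk setoid ⟨triple i x, i, triple_self i x⟩

/-- The change of coordinates `φⱼ ∘ φᵢ⁻¹`. -/
def transition (i j : Fin 3) (x : OctPlane) : OctPlane :=
  coords j fun k => triple i x k * (triple i x j)⁻¹

theorem param_eq_param_iff (i j : Fin 3) (x y : OctPlane) :
    param i x = param j y ↔ triple i x j ≠ 0 ∧ y = transition i j x := by
  constructor
  · intro h
    obtain ⟨l, hl, h⟩ : Proportional (triple i x) (triple j y) := Quotient.exact h
    have hj := h j
    rw [triple_self, one_mul] at hj
    refine ⟨hj ▸ hl, ?_⟩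
    have : (fun k => triple i x k * (triple i x j)⁻¹) = triple j y := by
      funext k
      rw [hj, h k, Octonion.mul_mul_inv _ hl]
    rw [transition, this, coords_triple]
  · rintro ⟨h0, rfl⟩
    refine Quotient.sound ⟨triple i x j, h0, fun k => ?_⟩
    simp only [transition]
    rw [triple_coords, Octonion.mul_inv_mul _ h0]
    exact Octonion.mul_inv_self h0

theorem param_injective (i : Fin 3) : Function.Injective (param i) := fun x y h => by
  rw [((param_eq_param_iff i i x y).1 h).2, transition]
  have : (fun k => triple i x k * (triple i x i)⁻¹) = triple i x := by
    funext k
    rw [triple_self]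
    simpa using Octonion.mul_mul_inv (triple i x k) (one_ne_zero (α := Octonion))
  rw [this, coords_triple]

theorem exists_param (p : OP2) : ∃ i x, param i x = p := by
  induction p using Quotient.inductionOn with
  | h a =>
    obtain ⟨a, i, hi⟩ := a
    exact ⟨i, coords i a, congrArg (Quotient.mk setoid) (Subtype.ext (triple_coords i a hi))⟩

theorem contDiff_triple (i k : Fin 3) : ContDiff ℝ ∞ fun x => triple i x k := by
  rcases Fin.eq_self_or_eq_succAbove i k with rfl | ⟨k, rfl⟩
  · simp only [triple_self]
    exact contDiff_const
  · simp only [triple, Fin.insertNth_apply_succAbove]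
    fin_cases k
    · exact contDiff_fst
    · exact contDiff_snd

theorem contDiffOn_transition (i j : Fin 3) :
    ContDiffOn ℝ ∞ (transition i j) {x | triple i x j ≠ 0} := by
  have hinv : ContDiffOn ℝ ∞ (fun x => (triple i x j)⁻¹) {x | triple i x j ≠ 0} :=
    ContDiffOn.comp (g := fun a : Octonion => a⁻¹) Octonion.contDiffOn_inv
      (contDiff_triple i j).contDiffOn fun x hx => hx
  have h : ∀ k, ContDiffOn ℝ ∞ (fun x => triple i x k * (triple i x j)⁻¹)
      {x | triple i x j ≠ 0} := fun k =>
    ContDiff.comp_contDiffOn (g := fun p : Octonion × Octonion => p.1 * p.2)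
      (f := fun x => (triple i x k, (triple i x j)⁻¹)) Octonion.contDiff_mul
      ((contDiff_triple i k).contDiffOn.prodMk hinv)
  exact (h (j.succAbove 0)).prodMk (h (j.succAbove 1))

theorem isOpen_domain (i j : Fin 3) : IsOpen {x | triple i x j ≠ 0} :=
  isOpen_ne_fun (contDiff_triple i j).continuous continuous_const

/-- The topology glued from the three affine charts: a set is open if and only if its
preimages in all three copies of `𝕆²` are open. -/
instance : TopologicalSpace OP2 := ⨆ i, TopologicalSpace.coinduced (param i) inferInstance

theorem isOpenEmbedding_param (i : Fin 3) : Topology.IsOpenEmbedding (param i) := by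
  refine .of_continuous_injective_isOpenMap ?_ (param_injective i) fun W hW => ?_
  · exact continuous_iff_coinduced_le.2 (le_iSup (fun i =>
      TopologicalSpace.coinduced (param i) inferInstance) i)
  · rw [isOpen_iSup_iff]
    intro j
    rw [isOpen_coinduced]
    have : param j ⁻¹' (param i '' W) = {x | triple j x i ≠ 0} ∩ transition j i ⁻¹' W := by
      ext x
      constructor
      · rintro ⟨w, hw, h⟩
        obtain ⟨h0, rfl⟩ := (param_eq_param_iff j i x w).1 h.symm
        exact ⟨h0, hw⟩
      · rintro ⟨h0, hw⟩
        exact ⟨_, hw, ((param_eq_param_iff j i x _).2 ⟨h0, rfl⟩).symm⟩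
    rw [this]
    exact (contDiffOn_transition j i).continuousOn.isOpen_inter_preimage (isOpen_domain j i) hW

/-- The affine chart `φᵢ : Uᵢ/∼ → 𝕆²`. -/
def chart (i : Fin 3) : OpenPartialHomeomorph OP2 OctPlane :=
  ((isOpenEmbedding_param i).toOpenPartialHomeomorph (param i)).symm

open Classical in
/-- The index of the first affine chart that contains `p`. -/
def chartIndex (p : OP2) : Fin 3 :=
  if p ∈ Set.range (param 0) then 0 else if p ∈ Set.range (param 1) then 1 else 2

theorem mem_range_param_chartIndex (p : OP2) : p ∈ Set.range (param (chartIndex p)) := by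
  unfold chartIndex
  split_ifs with h0 h1
  · exact h0
  · exact h1
  · obtain ⟨i, x, rfl⟩ := exists_param p
    fin_cases i
    · exact absurd ⟨x, rfl⟩ h0
    · exact absurd ⟨x, rfl⟩ h1
    · exact ⟨x, rfl⟩

instance : ChartedSpace OctPlane OP2 where
  atlas := Set.range chart
  chartAt p := chart (chartIndex p)
  mem_chart_source p := by
    simpa [chart] using mem_range_param_chartIndex p
  chart_mem_atlas p := ⟨_, rfl⟩

instance : IsManifold 𝓘(ℝ, OctPlane) ∞ OP2 := by
  refine isManifold_of_contDiffOn _ _ _ ?_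
  rintro _ _ ⟨i, rfl⟩ ⟨j, rfl⟩
  have hsrc : ((chart i).symm ≫ₕ chart j).source ⊆ {x | triple i x j ≠ 0} := by
    intro x hx
    simp only [chart, OpenPartialHomeomorph.symm_symm, OpenPartialHomeomorph.trans_source,
      OpenPartialHomeomorph.symm_source, Topology.IsOpenEmbedding.toOpenPartialHomeomorph_source,
      Topology.IsOpenEmbedding.toOpenPartialHomeomorph_target, Set.univ_inter,
      Topology.IsOpenEmbedding.toOpenPartialHomeomorph_apply] at hx
    obtain ⟨y, hy⟩ := hx
    exact ((param_eq_param_iff i j x y).1 hy.symm).1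
  simp only [modelWithCornersSelf_coe, modelWithCornersSelf_coe_symm, Set.range_id, Set.inter_univ,
    Set.preimage_id_eq, id_eq, CompTriple.comp_eq]
  refine ((contDiffOn_transition i j).mono hsrc).congr fun x hx => ?_
  have h : param i x = param j (transition i j x) :=
    (param_eq_param_iff i j x _).2 ⟨hsrc hx, rfl⟩
  change ((isOpenEmbedding_param j).toOpenPartialHomeomorph (param j)).symm (param i x) = _
  rw [h]
  exact (isOpenEmbedding_param j).toOpenPartialHomeomorph_left_inv (param j)

end OP2

section Riemannian

variable {E : Type*} [NormedAddCommGroup E] [NormedSpace ℝ E]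

/-- The Christoffel symbols of the first kind of the metric `G` on (an open subset of) `E`, as the
linear form `c ↦ ½ (∂_a G(b, c) + ∂_b G(a, c) - ∂_c G(a, b))`. -/
def christoffelFirst (G : E → E →L[ℝ] E →L[ℝ] ℝ) (x a b : E) : E →L[ℝ] ℝ :=
  (1 / 2 : ℝ) • (fderiv ℝ G x a b + fderiv ℝ G x b a - ((fderiv ℝ G x).flip a).flip b)

/-- The Christoffel symbols of the second kind: `G (Γ(a, b), c) = christoffelFirst G x a b c` for
all `c`, whenever `G x` is non-degenerate. -/
def christoffel (G : E → E →L[ℝ] E →L[ℝ] ℝ) (x a b : E) : E :=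
  (G x).inverse (christoffelFirst G x a b)

/-- The curvature operator in coordinates, with the sign convention
`R(a, b)c = ∂_b Γ(a, c) - ∂_a Γ(b, c) + Γ(b, Γ(a, c)) - Γ(a, Γ(b, c))`. -/
def coordCurvature (G : E → E →L[ℝ] E →L[ℝ] ℝ) (x a b c : E) : E :=
  fderiv ℝ (fun y => christoffel G y a c) x b - fderiv ℝ (fun y => christoffel G y b c) x a
    + christoffel G x b (christoffel G x a c) - christoffel G x a (christoffel G x b c)

variable {M : Type*} [TopologicalSpace M] [ChartedSpace E M]

/-- The coordinate expression, in the preferred chart at `p`, of a field `g` of bilinear forms on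
the tangent spaces of `M`: its pullback under the inverse of the chart. -/
def chartMetric
    (g : ∀ q : M, TangentSpace 𝓘(ℝ, E) q →L[ℝ] TangentSpace 𝓘(ℝ, E) q →L[ℝ] ℝ)
    (p : M) (x : E) : E →L[ℝ] E →L[ℝ] ℝ :=
  let G : E →L[ℝ] E →L[ℝ] ℝ := g ((chartAt E p).symm x)
  let D : E →L[ℝ] E := mfderiv 𝓘(ℝ, E) 𝓘(ℝ, E) (chartAt E p).symm x
  G.bilinearComp D D

/-- The Riemann curvature tensor `R(a, b, c, d) = g(R(a, b)c, d)` of `g` at `p`. The tangent space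
at `p` is identified with `E` by the preferred chart at `p`. -/
def riemannCurvature
    (g : ∀ q : M, TangentSpace 𝓘(ℝ, E) q →L[ℝ] TangentSpace 𝓘(ℝ, E) q →L[ℝ] ℝ)
    (p : M) (a b c d : TangentSpace 𝓘(ℝ, E) p) : ℝ :=
  g p (coordCurvature (E := E) (chartMetric g p) (chartAt E p p) a b c) d

/-- A diffeomorphism that preserves `g`. -/
def IsMetricIsometry
    (g : ∀ q : M, TangentSpace 𝓘(ℝ, E) q →L[ℝ] TangentSpace 𝓘(ℝ, E) q →L[ℝ] ℝ)
    (f : M ≃ₘ^∞⟮𝓘(ℝ, E), 𝓘(ℝ, E)⟯ M) : Prop :=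
  ∀ (q : M) (v w : TangentSpace 𝓘(ℝ, E) q),
    g (f q) (mfderiv 𝓘(ℝ, E) 𝓘(ℝ, E) f q v) (mfderiv 𝓘(ℝ, E) 𝓘(ℝ, E) f q w) = g q v w

/-- The isometries of `g` act transitively. -/
def IsHomogeneousMetric
    (g : ∀ q : M, TangentSpace 𝓘(ℝ, E) q →L[ℝ] TangentSpace 𝓘(ℝ, E) q →L[ℝ] ℝ) : Prop :=
  ∀ p q : M, ∃ f : M ≃ₘ^∞⟮𝓘(ℝ, E), 𝓘(ℝ, E)⟯ M, IsMetricIsometry g f ∧ f p = q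

end Riemannian

/-- The symmetric bilinear form on `𝕆²` whose quadratic form is
`(du, dv) ↦ α |du|² + β |dv|² + 2 Re[q (dv dū)]`. -/
def planeForm (α β : ℝ) (q : Octonion) : OctPlane →L[ℝ] OctPlane →L[ℝ] ℝ :=
  (LinearMap.mk₂ ℝ (fun X Y : OctPlane =>
      α * inner ℝ X.1 Y.1 + β * inner ℝ X.2 Y.2
        + ((q * (X.2 * star Y.1)).re + (q * (Y.2 * star X.1)).re))
    (fun X X' Y => by
      simp only [Prod.fst_add, Prod.snd_add, inner_add_left, Octonion.star_add', add_mul, mul_add,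
        Octonion.re_add]
      ring)
    (fun r X Y => by
      simp only [Prod.smul_fst, Prod.smul_snd, real_inner_smul_left, Octonion.star_smul',
        smul_mul_assoc, mul_smul_comm, Octonion.re_smul, smul_eq_mul]
      ring)
    (fun X Y Y' => by
      simp only [Prod.fst_add, Prod.snd_add, inner_add_right, Octonion.star_add', add_mul, mul_add,
        Octonion.re_add]
      ring)
    (fun r X Y => by
      simp only [Prod.smul_fst, Prod.smul_snd, real_inner_smul_right, Octonion.star_smul',
        smul_mul_assoc, mul_smul_comm, Octonion.re_smul, smul_eq_mul]
      ring)).toContinuousBilinearMap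

theorem planeForm_self (α β : ℝ) (q : Octonion) (X : OctPlane) :
    planeForm α β q X X
      = α * ‖X.1‖ ^ 2 + β * ‖X.2‖ ^ 2 + 2 * (q * (X.2 * star X.1)).re := by
  simp only [planeForm, LinearMap.toContinuousBilinearMap_apply, LinearMap.mk₂_apply,
    real_inner_self_eq_norm_sq]
  ring

/-- The metric of `𝕆P²` in an affine chart, at the point with coordinates `(u, v)`. -/
def projForm (x : OctPlane) : OctPlane →L[ℝ] OctPlane →L[ℝ] ℝ :=
  ((1 + ‖x.1‖ ^ 2 + ‖x.2‖ ^ 2) ^ 2)⁻¹ •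
    planeForm (1 + ‖x.2‖ ^ 2) (1 + ‖x.1‖ ^ 2) (-(x.1 * star x.2))

/-- `ds² = (|du|²(1+|v|²) + |dv|²(1+|u|²) - 2Re[(u v̄)(dv dū)]) / (1+|u|²+|v|²)²`. -/
theorem projForm_self (u v du dv : Octonion) :
    projForm (u, v) (du, dv) (du, dv)
      = (‖du‖ ^ 2 * (1 + ‖v‖ ^ 2) + ‖dv‖ ^ 2 * (1 + ‖u‖ ^ 2)
          - 2 * ((u * star v) * (dv * star du)).re) / (1 + ‖u‖ ^ 2 + ‖v‖ ^ 2) ^ 2 := by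
  simp only [projForm, smul_apply, planeForm_self, neg_mul, Octonion.re_neg,
    smul_eq_mul, div_eq_inv_mul]
  ring

/-- The metric of `𝕆H²` at the point `(u, v)`. -/
def hypForm (x : OctPlane) : OctPlane →L[ℝ] OctPlane →L[ℝ] ℝ :=
  ((1 - ‖x.1‖ ^ 2 - ‖x.2‖ ^ 2) ^ 2)⁻¹ •
    planeForm (1 - ‖x.2‖ ^ 2) (1 - ‖x.1‖ ^ 2) (x.1 * star x.2)

/-- `ds² = (|du|²(1-|v|²) + |dv|²(1-|u|²) + 2Re[(u v̄)(dv dū)]) / (1-|u|²-|v|²)²`. -/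
theorem hypForm_self (u v du dv : Octonion) :
    hypForm (u, v) (du, dv) (du, dv)
      = (‖du‖ ^ 2 * (1 - ‖v‖ ^ 2) + ‖dv‖ ^ 2 * (1 - ‖u‖ ^ 2)
          + 2 * ((u * star v) * (dv * star du)).re) / (1 - ‖u‖ ^ 2 - ‖v‖ ^ 2) ^ 2 := by
  simp only [hypForm, smul_apply, planeForm_self, smul_eq_mul, div_eq_inv_mul]
  ring

/-- The metric of `𝕆P²`, given by the same formula in each affine chart. The tangent space at `p` is
identified with `𝕆²` by the preferred affine chart at `p`, which is the chart `[1, u, v] ↦ (u, v)`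
at every point of the form `[1, u, v]`. -/
def OP2.metric (p : OP2) :
    TangentSpace 𝓘(ℝ, OctPlane) p →L[ℝ] TangentSpace 𝓘(ℝ, OctPlane) p →L[ℝ] ℝ :=
  projForm (chartAt OctPlane p p)

/-- The point `[1, 0, 0]`. -/
def OP2.basePoint : OP2 := OP2.param 0 (0, 0)

/-- The octonionic hyperbolic plane: the open unit ball `|u|² + |v|² < 1` of `𝕆²`, with the smooth
structure of an open subset. -/
def OH2 : TopologicalSpace.Opens OctPlane where
  carrier := {x | ‖x.1‖ ^ 2 + ‖x.2‖ ^ 2 < 1}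
  is_open' := isOpen_lt (by fun_prop) continuous_const

/-- The metric of `𝕆H²`. -/
def OH2.metric (p : OH2) :
    TangentSpace 𝓘(ℝ, OctPlane) p →L[ℝ] TangentSpace 𝓘(ℝ, OctPlane) p →L[ℝ] ℝ :=
  hypForm p

/-- The point `(0, 0)`. -/
def OH2.origin : OH2 := ⟨(0, 0), by simp [OH2]⟩

end

/-! Homogeneity rests on two families of explicit isometries of the ball. The linear maps (u, v) ↦
(t u + x v, x̄ u - t v) with t² + |x|² = 1 (`spinReflection`) carry any point to an axis and then,
with t = 0, to a real point (R, 0). The boosts (u, v) ↦ ((s + c u)(c + s u)⁻¹, v (c + s u)⁻¹) with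
c² - s² = 1 carry (R, 0) to the origin.

The linear maps preserve the metric because its numerator depends only on Euclidean norms and inner
products in 𝕆² and on the length of the vector (⟨u, du⟩ - ⟨v, dv⟩, u dv̄ + du v̄) of ℝ ⊕ 𝕆, on which
they act by ξ ↦ 2⟨e, ξ⟩e - ξ with e = (t, x) a unit vector (`mul_star_spinReflection_add`). For a
boost with w = c + s u, the derivative is du ↦ w⁻¹ du w⁻¹, dv ↦ (dv - s (v w⁻¹) du) w⁻¹, and the
metric is compared directly (`hypForm_boost`). In both cases the Moufang identities stand in for
associativity.

For the curvature, both metrics belong to one family (1 + εN)⁻² (P + εQ), with N and Q quadratic in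
the point and ε = 1, -1 (`affineForm`). First derivatives vanish at the origin, so the curvature
there is an alternation of second derivatives (`apply_coordCurvature`). The Hessian is ε times a
fixed tensor, which gives the opposite signs. The explicit formula then follows from the polarized
identity |a b̄|² = |a|²|b|² (`affineHess_alternation`).

Positivity comes from Cauchy–Schwarz, and simple connectedness from convexity of the ball. -/

namespace Octonion

/-! ### Octonion algebra: adjoints, alternativity, Moufang identities -/

theorem inner_eq_sum (a b : Octonion) : inner ℝ a b =
    a.fst.re * b.fst.re + a.fst.imI * b.fst.imI + a.fst.imJ * b.fst.imJ + a.fst.imK * b.fst.imK +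
      (a.snd.re * b.snd.re + a.snd.imI * b.snd.imI + a.snd.imJ * b.snd.imJ
        + a.snd.imK * b.snd.imK) := by
  rw [inner_eq_re]
  simp [re]
  ring

theorem mul_mul_self_left (a b : Octonion) : a * (a * b) = a * a * b := by
  ext <;> simp <;> ring

theorem mul_star_mul (a b : Octonion) : a * (star a * b) = (‖a‖ ^ 2) • b := by
  have h := star_mul_mul (star a) b
  rwa [star_star', norm_star'] at h

theorem mul_star_mul' (a b : Octonion) : b * star a * a = (‖a‖ ^ 2) • b := by
  have h := mul_mul_star b (star a)
  rwa [star_star', norm_star'] at h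

theorem inner_mul_left_adjoint (a b c : Octonion) :
    inner ℝ (a * b) c = inner ℝ b (star a * c) := by
  simp only [inner_eq_sum]
  simp
  ring

theorem inner_mul_right_adjoint (a b c : Octonion) :
    inner ℝ (a * b) c = inner ℝ a (c * star b) := by
  simp only [inner_eq_sum]
  simp
  ring

theorem inner_star_star (a b : Octonion) : inner ℝ (star a) (star b) = inner ℝ a b := by
  simp only [inner_eq_sum]
  simp

theorem re_mul_eq_inner (a b : Octonion) : (a * b).re = inner ℝ a (star b) := by
  rw [inner_eq_re, star_star']

theorem inner_mul_mul_left (a b c : Octonion) :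
    inner ℝ (a * b) (a * c) = ‖a‖ ^ 2 * inner ℝ b c := by
  rw [inner_mul_left_adjoint, star_mul_mul, real_inner_smul_right]

theorem inner_mul_mul_right (a b c : Octonion) :
    inner ℝ (b * a) (c * a) = ‖a‖ ^ 2 * inner ℝ b c := by
  rw [inner_mul_right_adjoint, mul_mul_star, real_inner_smul_right]

/-- The polarization of `|a b̄|² = |a|² |b|²` in both factors. -/
theorem inner_mul_star_add_exchange (a b c d : Octonion) :
    inner ℝ (a * star b) (c * star d) + inner ℝ (a * star d) (c * star b)
      = 2 * inner ℝ a c * inner ℝ b d := by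
  simp only [inner_eq_sum]
  simp
  ring

/-- `x ȳ x = 2⟨x, y⟩x - |x|² y`. -/
theorem mul_star_mul_self (x y : Octonion) :
    x * star y * x = (2 * inner ℝ x y) • x - (‖x‖ ^ 2) • y := by
  simp only [inner_eq_sum, norm_sq_eq, sub_eq_add_neg, ← neg_smul]
  ext <;> simp <;> ring

theorem star_neg' (a : Octonion) : star (-a) = -star a := by
  rw [← neg_one_smul ℝ a, star_smul', neg_one_smul]

theorem star_sub' (a b : Octonion) : star (a - b) = star a - star b := by
  rw [sub_eq_add_neg, star_add', star_neg', sub_eq_add_neg]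

/-- Polarization of (p b) b̄ = |b|² p in b. Together with its mirror image `star_mul_mul_add` it is
the usable form of alternativity below. -/
theorem mul_mul_star_add (p b c : Octonion) :
    p * b * star c + p * c * star b = (2 * inner ℝ b c) • p := by
  have h := mul_mul_star p (b + c)
  simp only [star_add', mul_add, add_mul, mul_mul_star] at h
  rw [norm_add_sq_real, add_smul, add_smul] at h
  rw [← sub_eq_zero] at h ⊢
  rw [← h]
  abel

theorem star_mul_mul_add (b c p : Octonion) :
    star b * (c * p) + star c * (b * p) = (2 * inner ℝ b c) • p := by
  have h := star_mul_mul (b + c) p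
  simp only [star_add', mul_add, add_mul, star_mul_mul] at h
  rw [norm_add_sq_real, add_smul, add_smul] at h
  rw [← sub_eq_zero] at h ⊢
  rw [← h]
  abel

/-- The middle Moufang identity. -/
theorem moufang_middle (a x y : Octonion) : (a * x) * (y * a) = a * (x * y) * a := by
  have hr := mul_star_mul_self a (star (x * y))
  rw [star_star'] at hr
  rw [hr]
  refine ext_inner_right ℝ fun z => ?_
  -- Pairing with z and exchanging a with z between the two products produces (x̄ ā) a = |a|² x̄, so
  -- no further associativity is needed.
  have h := inner_mul_star_add_exchange y (star a) (star (a * x)) (star z)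
  rw [star_star', star_star', star_mul', mul_star_mul', real_inner_smul_right] at h
  have h1 : inner ℝ y (star x * star a) = inner ℝ a (star (x * y)) := by
    rw [← inner_star_star a, star_star', ← star_star' x, ← inner_mul_left_adjoint, star_star',
      real_inner_comm]
  have h2 : inner ℝ (y * z) (star x) = inner ℝ (star (x * y)) z := by
    rw [inner_mul_left_adjoint, star_mul', real_inner_comm]
  rw [inner_mul_left_adjoint, star_mul', inner_sub_left, real_inner_smul_left,
    real_inner_smul_left]
  rw [h1, h2, inner_star_star] at h
  linarith

/-- The right Moufang identity. -/
theorem moufang_right (a x y : Octonion) : x * (a * y * a) = ((x * a) * y) * a := by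
  -- The element a y a is a real combination of a and ȳ, so the polarized alternative law suffices.
  have hr := mul_star_mul_self a (star y)
  rw [star_star'] at hr
  have h := mul_mul_star_add (x * a) y (star a)
  rw [star_star', mul_mul_star] at h
  rw [hr, mul_sub, mul_smul_comm, mul_smul_comm, eq_sub_of_add_eq h, smul_mul_assoc,
    ← inner_star_star a, star_star', real_inner_comm]

/-- A form of the left Moufang identity. -/
theorem moufang_left (a x y : Octonion) :
    (a * x * a) * (star a * y) = (‖a‖ ^ 2) • (a * (x * y)) := by
  have hr := mul_star_mul_self a (star x)
  rw [star_star'] at hr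
  have h := star_mul_mul_add (star a) x y
  rw [star_star'] at h
  rw [hr, sub_mul, smul_mul_assoc, smul_mul_assoc, mul_star_mul, eq_sub_of_add_eq h,
    ← inner_star_star a, star_star', smul_sub, smul_comm]

theorem inv_eq (a : Octonion) : a⁻¹ = (‖a‖ ^ 2)⁻¹ • star a := rfl

end Octonion

/-! ### The hyperbolic metric as a quadratic form, and its positivity -/

open Octonion

theorem planeForm_apply (α β : ℝ) (q : Octonion) (X Y : OctPlane) :
    planeForm α β q X Y = α * inner ℝ X.1 Y.1 + β * inner ℝ X.2 Y.2
      + (inner ℝ q (Y.1 * star X.2) + inner ℝ q (X.1 * star Y.2)) := by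
  simp only [planeForm, LinearMap.toContinuousBilinearMap_apply, LinearMap.mk₂_apply,
    re_mul_eq_inner, star_mul', star_star']

theorem planeForm_comm (α β : ℝ) (q : Octonion) (X Y : OctPlane) :
    planeForm α β q X Y = planeForm α β q Y X := by
  simp only [planeForm_apply, real_inner_comm X.1, real_inner_comm X.2]
  ring

theorem hypForm_comm (x X Y : OctPlane) : hypForm x X Y = hypForm x Y X := by
  simp only [hypForm, smul_apply, planeForm_comm _ _ _ X Y]

/-- Writing Re[(u v̄)(dv dū)] as ⟨u v̄, du dv̄⟩ opens the cross term to Cauchy–Schwarz and to the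
adjoint rules. -/
theorem hypForm_apply_self (x X : OctPlane) :
    hypForm x X X = (‖X.1‖ ^ 2 * (1 - ‖x.2‖ ^ 2) + ‖X.2‖ ^ 2 * (1 - ‖x.1‖ ^ 2)
      + 2 * inner ℝ (x.1 * star x.2) (X.1 * star X.2)) / (1 - ‖x.1‖ ^ 2 - ‖x.2‖ ^ 2) ^ 2 := by
  have h := hypForm_self x.1 x.2 X.1 X.2
  rwa [re_mul_eq_inner, star_mul', star_star'] at h

/-- By polarization, a linear map that preserves the quadratic form of the metric preserves the
metric. -/
theorem hypForm_map_map {x y : OctPlane} (D : OctPlane →L[ℝ] OctPlane)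
    (h : ∀ X, hypForm y (D X) (D X) = hypForm x X X) (X Y : OctPlane) :
    hypForm y (D X) (D Y) = hypForm x X Y := by
  have h' := h (X + Y)
  simp only [map_add, add_apply, h, hypForm_comm _ Y X, hypForm_comm _ (D Y) (D X)] at h'
  linarith

/-- Put δ = 1 - |u|² - |v|². By Cauchy–Schwarz the numerator is at least δ(|du|² + |dv|²) + (|u||du|
- |v||dv|)², and δ ≤ 1. The bound yields both definiteness and boundedness of the unit balls of the
metric. -/
theorem norm_sq_le_hypForm {x : OctPlane} (hx : ‖x.1‖ ^ 2 + ‖x.2‖ ^ 2 < 1) (X : OctPlane) :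
    ‖X.1‖ ^ 2 + ‖X.2‖ ^ 2 ≤ hypForm x X X := by
  have hd : 0 < 1 - ‖x.1‖ ^ 2 - ‖x.2‖ ^ 2 := by linarith
  have hd1 : 1 - ‖x.1‖ ^ 2 - ‖x.2‖ ^ 2 ≤ 1 := by nlinarith [sq_nonneg ‖x.1‖, sq_nonneg ‖x.2‖]
  have hc : |inner ℝ (x.1 * star x.2) (X.1 * star X.2)|
      ≤ (‖x.1‖ * ‖X.1‖) * (‖x.2‖ * ‖X.2‖) := by
    refine (abs_real_inner_le_norm _ _).trans (le_of_eq ?_)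
    have h : ∀ a b : Octonion, ‖a * star b‖ = ‖a‖ * ‖b‖ := fun a b => by
      rw [← sq_eq_sq₀ (norm_nonneg _) (by positivity), norm_mul_sq, norm_star', mul_pow]
    rw [h, h]
    ring
  have h1 := (abs_le.1 hc).1
  have h2 : (1 - ‖x.1‖ ^ 2 - ‖x.2‖ ^ 2) ^ 2 * (‖X.1‖ ^ 2 + ‖X.2‖ ^ 2)
      ≤ (1 - ‖x.1‖ ^ 2 - ‖x.2‖ ^ 2) * (‖X.1‖ ^ 2 + ‖X.2‖ ^ 2) := by
    gcongr
    nlinarith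
  rw [hypForm_apply_self, le_div_iff₀ (by positivity)]
  nlinarith [sq_nonneg (‖x.1‖ * ‖X.1‖ - ‖x.2‖ * ‖X.2‖)]

theorem hypForm_pos {x : OctPlane} (hx : ‖x.1‖ ^ 2 + ‖x.2‖ ^ 2 < 1) {X : OctPlane} (hX : X ≠ 0) :
    0 < hypForm x X X := by
  refine lt_of_lt_of_le ?_ (norm_sq_le_hypForm hx X)
  by_cases h0 : X.1 = 0
  · have : X.2 ≠ 0 := fun h => hX (Prod.ext h0 h)
    have := norm_pos_iff.2 this
    positivity
  · have := norm_pos_iff.2 h0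
    positivity

theorem Octonion.norm_sq_one : ‖(1 : Octonion)‖ ^ 2 = 1 := by
  have h := norm_mul_sq 1 1
  rw [mul_one] at h
  exact mul_left_cancel₀ (by simp : ‖(1 : Octonion)‖ ^ 2 ≠ 0) (by rw [← h, _root_.mul_one])

/-! ### Isometries from Spin(9) -/

section Reflection

/-- The reflection `(u, v) ↦ (t u + x v, x̄ u - t v)`, an element of `Spin(9)` when
`t² + |x|² = 1`. -/
noncomputable def spinReflection (t : ℝ) (x : Octonion) : OctPlane →L[ℝ] OctPlane :=
  LinearMap.toContinuousLinearMap
    { toFun := fun X => (t • X.1 + x * X.2, star x * X.1 - t • X.2)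
      map_add' := fun X Y => by
        ext1 <;> simp only [Prod.fst_add, Prod.snd_add, smul_add, mul_add] <;> abel
      map_smul' := fun r X => by
        ext1 <;> simp only [Prod.smul_fst, Prod.smul_snd, smul_add, smul_sub, mul_smul_comm,
          RingHom.id_apply, smul_comm t r] }

theorem spinReflection_apply (t : ℝ) (x : Octonion) (X : OctPlane) :
    spinReflection t x X = (t • X.1 + x * X.2, star x * X.1 - t • X.2) := rfl

variable {t : ℝ} {x : Octonion}

theorem spinReflection_spinReflection (h : t ^ 2 + ‖x‖ ^ 2 = 1) (X : OctPlane) :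
    spinReflection t x (spinReflection t x X) = X := by
  simp only [spinReflection_apply, mul_add, mul_sub, mul_smul_comm, mul_star_mul, star_mul_mul,
    smul_add, smul_sub, smul_smul]
  ext1
  · calc _ = (t ^ 2 + ‖x‖ ^ 2) • X.1 := by module
      _ = X.1 := by rw [h, one_smul]
  · calc _ = (t ^ 2 + ‖x‖ ^ 2) • X.2 := by module
      _ = X.2 := by rw [h, one_smul]

theorem inner_spinReflection_fst (X Y : OctPlane) :
    inner ℝ (spinReflection t x X).1 (spinReflection t x Y).1
      = t ^ 2 * inner ℝ X.1 Y.1 + ‖x‖ ^ 2 * inner ℝ X.2 Y.2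
        + t * inner ℝ x (X.1 * star Y.2 + Y.1 * star X.2) := by
  simp only [spinReflection_apply, inner_add_left, inner_add_right, real_inner_smul_left,
    real_inner_smul_right, inner_mul_mul_left]
  rw [inner_mul_right_adjoint x, real_inner_comm (x * Y.2) X.1, inner_mul_right_adjoint x]
  ring

theorem inner_spinReflection_snd (X Y : OctPlane) :
    inner ℝ (spinReflection t x X).2 (spinReflection t x Y).2
      = ‖x‖ ^ 2 * inner ℝ X.1 Y.1 + t ^ 2 * inner ℝ X.2 Y.2
        - t * inner ℝ x (X.1 * star Y.2 + Y.1 * star X.2) := by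
  have h : ∀ a b : Octonion, inner ℝ (star x * a) b = inner ℝ x (a * star b) := fun a b => by
    rw [inner_mul_right_adjoint, ← inner_star_star, star_star', star_mul', star_star']
  simp only [spinReflection_apply, inner_sub_left, inner_sub_right, real_inner_smul_left,
    real_inner_smul_right, inner_mul_mul_left, norm_star', inner_add_right]
  rw [h, real_inner_comm (star x * Y.1), h]
  ring

/-- Together with the difference of the two preceding lemmas, this says that (⟨X₁, Y₁⟩ - ⟨X₂, Y₂⟩,
V) in ℝ ⊕ 𝕆 undergoes ξ ↦ 2⟨e, ξ⟩e - ξ with e = (t, x), an orthogonal map. -/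
theorem mul_star_spinReflection_add (h : t ^ 2 + ‖x‖ ^ 2 = 1) (X Y : OctPlane) :
    (spinReflection t x X).1 * star (spinReflection t x Y).2
        + (spinReflection t x Y).1 * star (spinReflection t x X).2
      = (2 * (t * (inner ℝ X.1 Y.1 - inner ℝ X.2 Y.2)
          + inner ℝ x (X.1 * star Y.2 + Y.1 * star X.2))) • x
        - (X.1 * star Y.2 + Y.1 * star X.2) := by
  set V := X.1 * star Y.2 + Y.1 * star X.2 with hV
  have h1 := star_mul_mul_add (star X.1) (star Y.1) x
  rw [star_star', star_star', inner_star_star] at h1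
  have h2 := mul_mul_star_add x X.2 Y.2
  have h3 := mul_star_mul_self x V
  -- These are the only products beyond the reach of alternativity; the middle Moufang identity
  -- collects them.
  have h4 : (x * X.2) * (star Y.1 * x) + (x * Y.2) * (star X.1 * x) = x * star V * x := by
    rw [moufang_middle, moufang_middle, hV, star_add', star_mul', star_mul', star_star',
      star_star', mul_add, add_mul, add_comm]
  calc _ = t • (X.1 * (star Y.1 * x) + Y.1 * (star X.1 * x))
          - t • (x * X.2 * star Y.2 + x * Y.2 * star X.2)
          + ((x * X.2) * (star Y.1 * x) + (x * Y.2) * (star X.1 * x)) - (t ^ 2) • V := by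
        simp only [spinReflection_apply, star_sub', star_mul', star_star', star_smul', mul_sub,
          add_mul, smul_mul_assoc, mul_smul_comm, smul_add, smul_smul, hV, sq t]
        abel
    _ = (2 * (t * (inner ℝ X.1 Y.1 - inner ℝ X.2 Y.2) + inner ℝ x V)) • x
          - (t ^ 2 + ‖x‖ ^ 2) • V := by
        rw [h1, h2, h4, h3]
        module
    _ = _ := by rw [h, one_smul]

/-- The metric in terms of the action of `Spin(9)` on the nine-dimensional representation. -/
theorem hypForm_apply_self_eq_spin (x X : OctPlane) :
    hypForm x X X = ((1 - (‖x.1‖ ^ 2 + ‖x.2‖ ^ 2)) * (‖X.1‖ ^ 2 + ‖X.2‖ ^ 2)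
      + (‖x.1‖ ^ 2 + ‖x.2‖ ^ 2) * (‖X.1‖ ^ 2 + ‖X.2‖ ^ 2)
      + (inner ℝ x.1 X.1 + inner ℝ x.2 X.2) ^ 2
      - ((inner ℝ x.1 X.1 - inner ℝ x.2 X.2) ^ 2 + ‖x.1 * star X.2 + X.1 * star x.2‖ ^ 2))
      / (1 - (‖x.1‖ ^ 2 + ‖x.2‖ ^ 2)) ^ 2 := by
  rw [hypForm_apply_self, sub_sub]
  congr 1
  have h := inner_mul_star_add_exchange x.1 x.2 X.1 X.2
  rw [norm_add_sq_real, norm_mul_sq, norm_mul_sq, norm_star', norm_star']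
  linarith

theorem norm_sq_spinReflection (h : t ^ 2 + ‖x‖ ^ 2 = 1) (X : OctPlane) :
    ‖(spinReflection t x X).1‖ ^ 2 + ‖(spinReflection t x X).2‖ ^ 2
      = ‖X.1‖ ^ 2 + ‖X.2‖ ^ 2 := by
  simp only [← real_inner_self_eq_norm_sq] at h ⊢
  rw [inner_spinReflection_fst, inner_spinReflection_snd, ← real_inner_self_eq_norm_sq]
  linear_combination (inner ℝ X.1 X.1 + inner ℝ X.2 X.2) * h

theorem hypForm_spinReflection (h : t ^ 2 + ‖x‖ ^ 2 = 1) (y X : OctPlane) :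
    hypForm (spinReflection t x y) (spinReflection t x X) (spinReflection t x X)
      = hypForm y X X := by
  rw [hypForm_apply_self_eq_spin, hypForm_apply_self_eq_spin, norm_sq_spinReflection h,
    norm_sq_spinReflection h, mul_star_spinReflection_add h, inner_spinReflection_fst,
    inner_spinReflection_snd]
  congr 1
  generalize y.1 * star X.2 + X.1 * star y.2 = V
  rw [norm_sub_sq_real, norm_smul, real_inner_smul_left, mul_pow, Real.norm_eq_abs, sq_abs,
    eq_sub_of_add_eq' h]
  generalize inner ℝ y.1 X.1 = p
  generalize inner ℝ y.2 X.2 = q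
  generalize inner ℝ x V = r
  ring

/-- A reflection moves every point to the first octonionic axis. -/
theorem exists_spinReflection (y : OctPlane) : ∃ t x, t ^ 2 + ‖x‖ ^ 2 = 1 ∧
    (spinReflection t x y).2 = 0 := by
  by_cases hu : y.1 = 0
  · exact ⟨0, 1, by simp [norm_sq_one], by simp [spinReflection_apply, hu]⟩
  have hu' : 0 < ‖y.1‖ := norm_pos_iff.2 hu
  set R := √(‖y.1‖ ^ 2 + ‖y.2‖ ^ 2) with hR
  have hR2 : R ^ 2 = ‖y.1‖ ^ 2 + ‖y.2‖ ^ 2 := Real.sq_sqrt (by positivity)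
  have hR0 : 0 < R := Real.sqrt_pos.2 (by positivity)
  -- With y = (u, v), this x gives x̄ u = (v ū) u / (|u| R) = (|u| / R) v, which is exactly t v.
  refine ⟨‖y.1‖ / R, (‖y.1‖ * R)⁻¹ • (y.1 * star y.2), ?_, ?_⟩
  · rw [norm_smul, mul_pow, norm_mul_sq, norm_star', Real.norm_eq_abs, sq_abs]
    field_simp
    linarith
  · rw [spinReflection_apply]
    simp only
    rw [star_smul', Octonion.star_mul', star_star', smul_mul_assoc, mul_star_mul',
      smul_smul, ← sub_smul]
    have : (‖y.1‖ * R)⁻¹ * ‖y.1‖ ^ 2 - ‖y.1‖ / R = 0 := by field_simp; simp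
    rw [this, zero_smul]

end Reflection

/-! ### Inversion of octonions and its derivative -/

namespace Octonion

/-- Octonionic multiplication as a continuous bilinear map. -/
noncomputable def mulL : Octonion →L[ℝ] Octonion →L[ℝ] Octonion :=
  (LinearMap.mul ℝ Octonion).toContinuousBilinearMap

theorem mulL_apply (a b : Octonion) : mulL a b = a * b := rfl

/-- Differentiate a a⁻¹ = 1 and cancel w on the left by w⁻¹ (w z) = z. The derivative is k ↦ -w⁻¹ (k
w⁻¹), with this bracketing. -/
theorem hasFDerivAt_inv {w : Octonion} (hw : w ≠ 0) :
    HasFDerivAt (fun a : Octonion => a⁻¹) (-(mulL w⁻¹).comp (mulL.flip w⁻¹)) w := by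
  have hopen : {a : Octonion | a ≠ 0} ∈ 𝓝 w := isOpen_ne.mem_nhds hw
  have hd := ((contDiffOn_inv.contDiffAt hopen).differentiableAt (by simp)).hasFDerivAt
  have hmul := mulL.hasFDerivAt_of_bilinear (hasFDerivAt_id w) hd
  have hone : (fun a : Octonion => mulL (id a) a⁻¹) =ᶠ[𝓝 w] fun _ => 1 := by
    filter_upwards [hopen] with a ha
    exact mul_inv_self ha
  have h := (hmul.congr_of_eventuallyEq hone.symm).unique (hasFDerivAt_const (1 : Octonion) w)
  refine hd.congr_fderiv (ContinuousLinearMap.ext fun k => ?_)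
  have hk := congrArg (fun L => w⁻¹ * L k) h
  simp [ContinuousLinearMap.precompR, ContinuousLinearMap.precompL, mulL_apply, mul_add,
    inv_mul_mul _ hw] at hk
  simp only [neg_apply, ContinuousLinearMap.comp_apply, ContinuousLinearMap.flip_apply, mulL_apply]
  exact eq_neg_of_add_eq_zero_left hk

theorem norm_sq_inv (a : Octonion) : ‖a⁻¹‖ ^ 2 = (‖a‖ ^ 2)⁻¹ := by
  rw [inv_eq, norm_smul, mul_pow, norm_star', Real.norm_eq_abs, sq_abs]
  by_cases h : ‖a‖ ^ 2 = 0
  · simp [h]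
  · field_simp

theorem star_one' : star (1 : Octonion) = 1 := by
  ext1 <;> simp

theorem star_eq (a : Octonion) : star a = (2 * inner ℝ 1 a) • 1 - a := by
  have h := star_mul_mul_add 1 a 1
  simp only [star_one', one_mul, mul_one] at h
  exact eq_sub_of_add_eq' h

theorem inv_inv' {a : Octonion} (ha : a ≠ 0) : a⁻¹⁻¹ = a := by
  have h := inv_mul_mul a (inv_ne_zero' ha)
  rwa [inv_mul_self ha, mul_one] at h

end Octonion

/-! ### Boosts along the first octonionic axis -/

section Boost

/-- The denominator `c + s u` of a boost. -/
noncomputable def boostDenom (c s : ℝ) (u : Octonion) : Octonion := c • 1 + s • u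

/-- The boost `(u, v) ↦ ((s + c u)(c + s u)⁻¹, v (c + s u)⁻¹)`. -/
noncomputable def boost (c s : ℝ) (x : OctPlane) : OctPlane :=
  (boostDenom s c x.1 * (boostDenom c s x.1)⁻¹, x.2 * (boostDenom c s x.1)⁻¹)

variable {c s : ℝ}

theorem norm_sq_boostDenom (c s : ℝ) (u : Octonion) :
    ‖boostDenom c s u‖ ^ 2 = c ^ 2 + 2 * c * s * inner ℝ 1 u + s ^ 2 * ‖u‖ ^ 2 := by
  rw [boostDenom, norm_add_sq_real, norm_smul, norm_smul, mul_pow, mul_pow, norm_sq_one,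
    real_inner_smul_left, real_inner_smul_right, Real.norm_eq_abs, Real.norm_eq_abs, sq_abs,
    sq_abs]
  ring

/-- The terms 2cs⟨1, u⟩ cancel. This keeps the denominator away from zero and the boost inside the
ball. -/
theorem norm_sq_boostDenom_sub (h : c ^ 2 - s ^ 2 = 1) (u : Octonion) :
    ‖boostDenom c s u‖ ^ 2 - ‖boostDenom s c u‖ ^ 2 = 1 - ‖u‖ ^ 2 := by
  rw [norm_sq_boostDenom, norm_sq_boostDenom]
  linear_combination (1 - ‖u‖ ^ 2) * h

theorem boostDenom_ne_zero (h : c ^ 2 - s ^ 2 = 1) {u : Octonion} (hu : ‖u‖ ^ 2 < 1) :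
    boostDenom c s u ≠ 0 := fun h0 => by
  have := norm_sq_boostDenom_sub h u
  rw [h0, norm_zero] at this
  nlinarith [sq_nonneg ‖boostDenom s c u‖]

theorem one_sub_norm_sq_boost (h : c ^ 2 - s ^ 2 = 1) {x : OctPlane} (hu : ‖x.1‖ ^ 2 < 1) :
    1 - ‖(boost c s x).1‖ ^ 2 - ‖(boost c s x).2‖ ^ 2
      = (‖boostDenom c s x.1‖ ^ 2)⁻¹ * (1 - ‖x.1‖ ^ 2 - ‖x.2‖ ^ 2) := by
  have hw : ‖boostDenom c s x.1‖ ^ 2 ≠ 0 := by simpa using boostDenom_ne_zero h hu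
  simp only [boost, norm_mul_sq, norm_sq_inv]
  rw [← norm_sq_boostDenom_sub h x.1]
  rw [mul_sub, mul_sub, inv_mul_cancel₀ hw]
  ring

/-- The derivative of the boost. -/
noncomputable def boostDeriv (c s : ℝ) (x : OctPlane) : OctPlane →L[ℝ] OctPlane :=
  let w := boostDenom c s x.1
  let D : OctPlane →L[ℝ] Octonion :=
    (s • -(mulL w⁻¹).comp (mulL.flip w⁻¹)).comp (ContinuousLinearMap.fst ℝ Octonion Octonion)
  (mulL (boostDenom s c x.1) ∘L D
      + mulL.flip w⁻¹ ∘L (c • ContinuousLinearMap.fst ℝ Octonion Octonion)).prod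
    (mulL x.2 ∘L D + mulL.flip w⁻¹ ∘L ContinuousLinearMap.snd ℝ Octonion Octonion)

theorem hasFDerivAt_boostDenom (c s : ℝ) (u : Octonion) :
    HasFDerivAt (boostDenom c s) (s • ContinuousLinearMap.id ℝ Octonion) u :=
  ((hasFDerivAt_id u).const_smul s).const_add (c • (1 : Octonion))

theorem hasFDerivAt_boost {x : OctPlane} (hw : boostDenom c s x.1 ≠ 0) :
    HasFDerivAt (boost c s) (boostDeriv c s x) x := by
  have hfst : HasFDerivAt (𝕜 := ℝ) (fun y : OctPlane => y.1) _ x := hasFDerivAt_fst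
  have hinv := (hasFDerivAt_inv hw).comp x ((hasFDerivAt_boostDenom c s x.1).comp x hfst)
  have h1 := mulL.hasFDerivAt_of_bilinear ((hasFDerivAt_boostDenom s c x.1).comp x hfst) hinv
  have h2 := mulL.hasFDerivAt_of_bilinear (hasFDerivAt_snd (p := x)) hinv
  refine (h1.prodMk h2).congr_fderiv (ContinuousLinearMap.ext fun X => ?_)
  simp [boostDeriv, ContinuousLinearMap.precompR, ContinuousLinearMap.precompL, mulL_apply]

theorem Octonion.mul_mul_self_flexible (a b : Octonion) : a * (b * a) = a * b * a := by
  simpa using moufang_middle a 1 b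

theorem smul_boostDenom_sub (h : c ^ 2 - s ^ 2 = 1) (u : Octonion) :
    c • boostDenom c s u - s • boostDenom s c u = 1 := by
  calc c • boostDenom c s u - s • boostDenom s c u = (c ^ 2 - s ^ 2) • 1 := by
        rw [boostDenom, boostDenom]
        module
    _ = 1 := by rw [h, one_smul]

/-- With w = c + s u and p = s + c u, the quotient rule gives (c w - s p)(w⁻¹ (du w⁻¹)), and c w - s
p = 1. -/
theorem boostDeriv_apply_fst (h : c ^ 2 - s ^ 2 = 1) {x : OctPlane}
    (hw : boostDenom c s x.1 ≠ 0) (X : OctPlane) :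
    (boostDeriv c s x X).1 = (boostDenom c s x.1)⁻¹ * X.1 * (boostDenom c s x.1)⁻¹ := by
  set w := boostDenom c s x.1 with hwdef
  have h1 : X.1 * w⁻¹ = w * (w⁻¹ * (X.1 * w⁻¹)) := by
    have := inv_mul_mul (X.1 * w⁻¹) (inv_ne_zero' hw)
    rw [inv_inv' hw] at this
    exact this.symm
  have h2 := smul_boostDenom_sub h x.1
  rw [← hwdef] at h2
  calc (boostDeriv c s x X).1
      = c • (X.1 * w⁻¹) - s • (boostDenom s c x.1 * (w⁻¹ * (X.1 * w⁻¹))) := by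
        simp [boostDeriv, mulL_apply, ← hwdef]
        abel
    _ = (c • w - s • boostDenom s c x.1) * (w⁻¹ * (X.1 * w⁻¹)) := by
        rw [sub_mul, smul_mul_assoc, smul_mul_assoc, ← h1]
    _ = _ := by rw [h2, one_mul, mul_mul_self_flexible]

/-- The right Moufang identity pulls a common factor w⁻¹ out on the right, so that its norm splits
off. -/
theorem boostDeriv_apply_snd (c s : ℝ) (x X : OctPlane) :
    (boostDeriv c s x X).2
      = (X.2 - s • (x.2 * (boostDenom c s x.1)⁻¹ * X.1)) * (boostDenom c s x.1)⁻¹ := by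
  rw [sub_mul, smul_mul_assoc, ← moufang_right, ← mul_mul_self_flexible]
  simp [boostDeriv, mulL_apply]
  abel

/-- Left alternativity u (u z) = (u u) z makes left multiplication by real combinations of 1 and u
associative. -/
theorem Octonion.boostDenom_mul_assoc (a b c d : ℝ) (u z : Octonion) :
    boostDenom a b u * (boostDenom c d u * z) = boostDenom a b u * boostDenom c d u * z := by
  simp only [boostDenom, add_mul, mul_add, smul_mul_assoc, mul_smul_comm, one_mul, mul_one,
    mul_mul_self_left]

/-- Conjugates stay in the real span of 1 and u, so `boostDenom_mul_assoc` applies to them as well.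
-/
theorem star_boostDenom (c s : ℝ) (u : Octonion) :
    star (boostDenom c s u) = boostDenom (c + 2 * s * inner ℝ 1 u) (-s) u := by
  rw [boostDenom, star_add', star_smul', star_smul', star_eq u, star_one', boostDenom]
  module

/-- Everything reduces to |u|, |v|, |du|, |dv|, n = |w|², ⟨1, u⟩ and the two inner products K = ⟨w
v̄, du dv̄⟩ and L = ⟨u v̄, du dv̄⟩. The nonassociative difficulty sits in the cross term. -/
theorem hypForm_boost (h : c ^ 2 - s ^ 2 = 1) {x : OctPlane} (hx : ‖x.1‖ ^ 2 + ‖x.2‖ ^ 2 < 1)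
    (X : OctPlane) :
    hypForm (boost c s x) (boostDeriv c s x X) (boostDeriv c s x X) = hypForm x X X := by
  have hu : ‖x.1‖ ^ 2 < 1 := by nlinarith [sq_nonneg ‖x.2‖]
  have hw := boostDenom_ne_zero h hu
  have hD : 1 - ‖x.1‖ ^ 2 - ‖x.2‖ ^ 2 ≠ 0 := by linarith
  rw [hypForm_apply_self, hypForm_apply_self, one_sub_norm_sq_boost h hu,
    boostDeriv_apply_fst h hw, boostDeriv_apply_snd, boost]
  have hsub := norm_sq_boostDenom_sub h x.1
  have hnorm := norm_sq_boostDenom c s x.1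
  have hstar := star_boostDenom c s x.1
  have hinner : inner ℝ x.1 (boostDenom c s x.1) = c * inner ℝ 1 x.1 + s * ‖x.1‖ ^ 2 := by
    rw [boostDenom, inner_add_right, real_inner_smul_right, real_inner_smul_right,
      real_inner_comm, real_inner_self_eq_norm_sq]
  -- Since w̄ u = c u + s|u|², the numerator s + c u differs from w̄ u by a real number.
  have hp : boostDenom s c x.1
      = star (boostDenom c s x.1) * x.1 + (s * (1 - ‖x.1‖ ^ 2)) • 1 := by
    simp only [boostDenom, star_add', star_smul', add_mul, smul_mul_assoc]
    have h1 : star x.1 * x.1 = (‖x.1‖ ^ 2) • 1 := by simpa using star_mul_mul x.1 1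
    rw [h1, star_one', one_mul]
    module
  have hassoc : ∀ z, (star (boostDenom c s x.1) * x.1) * z
      = star (boostDenom c s x.1) * (x.1 * z) := fun z => by
    have := boostDenom_mul_assoc (c + 2 * s * inner ℝ 1 x.1) (-s) 0 1 x.1 z
    rw [hstar]
    simpa [boostDenom] using this.symm
  have hassoc' : ∀ z, (boostDenom s c x.1 * star (boostDenom c s x.1)) * (boostDenom c s x.1 * z)
      = (‖boostDenom c s x.1‖ ^ 2) • (boostDenom s c x.1 * z) := fun z => by
    rw [hstar, ← boostDenom_mul_assoc, ← hstar, star_mul_mul, mul_smul_comm]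
  clear hstar
  generalize boostDenom c s x.1 = w at *
  generalize boostDenom s c x.1 = p at *
  obtain ⟨u, v⟩ := x
  obtain ⟨du, dv⟩ := X
  simp only at *
  have hn : ‖w‖ ^ 2 ≠ 0 := by simpa using hw
  set n := ‖w‖ ^ 2 with hndef
  have hpv : w * (p * star v) = n • (u * star v) + (s * (1 - ‖u‖ ^ 2)) • (w * star v) := by
    rw [hp, add_mul, smul_mul_assoc, one_mul, hassoc, mul_add, mul_star_mul, mul_smul_comm]
  set η := dv - s • (v * w⁻¹ * du) with hη
  have hη' : η = dv - (s * n⁻¹) • (v * star w * du) := by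
    rw [hη, inv_eq, mul_smul_comm, smul_mul_assoc, smul_smul]
  have hdη : du * star η = du * star dv - (s * n⁻¹ * ‖du‖ ^ 2) • (w * star v) := by
    rw [hη', star_sub', star_smul', star_mul', star_mul', star_star', mul_sub, mul_smul_comm,
      mul_star_mul, smul_smul]
  have hK : inner ℝ dv (v * star w * du) = inner ℝ (w * star v) (du * star dv) := by
    rw [real_inner_comm, inner_mul_right_adjoint, ← inner_star_star]
    simp only [star_mul', star_star']
  have hηn : ‖η‖ ^ 2 = ‖dv‖ ^ 2 - 2 * (s * n⁻¹) * inner ℝ (w * star v) (du * star dv)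
      + (s * n⁻¹) ^ 2 * (‖v‖ ^ 2 * n * ‖du‖ ^ 2) := by
    rw [hη', norm_sub_sq_real, real_inner_smul_right, hK, norm_smul, mul_pow, norm_mul_sq,
      norm_mul_sq, norm_star', Real.norm_eq_abs, sq_abs]
    ring
  -- Left Moufang with a = w̄ turns (w̄ du w̄)(w η̄) into n w̄ (du η̄); the outer w̄ then passes to
  -- the other side as w, where `hpv` applies.
  have hcross : inner ℝ ((p * w⁻¹) * star (v * w⁻¹)) ((w⁻¹ * du * w⁻¹) * star (η * w⁻¹))
      = (n⁻¹) ^ 2 * (inner ℝ (u * star v) (du * star η)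
        + n⁻¹ * (s * (1 - ‖u‖ ^ 2)) * inner ℝ (w * star v) (du * star η)) := by
    have hm := moufang_left (star w) du (star η)
    rw [star_star', norm_star', ← hndef] at hm
    simp only [inv_eq, ← hndef, star_mul', star_smul', star_star', smul_mul_assoc, mul_smul_comm,
      hassoc', hm, real_inner_smul_left, real_inner_smul_right]
    rw [real_inner_comm, inner_mul_left_adjoint, star_star', real_inner_comm, hpv,
      inner_add_left, real_inner_smul_left, real_inner_smul_left]
    field_simp
  have h1 : inner ℝ (u * star v) (w * star v) = ‖v‖ ^ 2 * inner ℝ u w := by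
    rw [inner_mul_mul_right, norm_star']
  have h2 : inner ℝ (w * star v) (w * star v) = ‖v‖ ^ 2 * n := by
    rw [inner_mul_mul_right, norm_star', real_inner_self_eq_norm_sq]
  rw [hcross, hdη, inner_sub_right, inner_sub_right, real_inner_smul_right, real_inner_smul_right,
    h1, h2]
  simp only [norm_mul_sq, norm_sq_inv, ← hndef]
  rw [hηn, hinner, eq_sub_of_add_eq (sub_eq_iff_eq_add'.1 hsub).symm]
  generalize inner ℝ (w * star v) (du * star dv) = K
  generalize inner ℝ (u * star v) (du * star dv) = L
  -- After K and L cancel, only multiples of |du|²|v|² remain; they match by c² = 1 + s² and the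
  -- expansion of n.
  have hbr : 1 + 2 * s * (c * inner ℝ 1 u + s * ‖u‖ ^ 2) + s ^ 2 * (1 - ‖u‖ ^ 2) = n := by
    linear_combination -h - hnorm
  generalize inner ℝ 1 u = I at *
  clear_value n
  field_simp
  linear_combination (-‖du‖ ^ 2 * ‖v‖ ^ 2) * hbr

/-- At the image point the new denominator is w⁻¹ and the new numerator u w⁻¹, so the cancellation
(a b) b⁻¹ = a replaces associativity. -/
theorem boost_neg_boost (h : c ^ 2 - s ^ 2 = 1) {x : OctPlane}
    (hw : boostDenom c s x.1 ≠ 0) : boost c (-s) (boost c s x) = x := by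
  have h1 : boostDenom c (-s) (boost c s x).1 = (boostDenom c s x.1)⁻¹ := by
    have := congrArg (· * (boostDenom c s x.1)⁻¹) (smul_boostDenom_sub h x.1)
    simp only [sub_mul, smul_mul_assoc, mul_inv_self hw, one_mul] at this
    rw [← this, boost]
    simp only [boostDenom]
    module
  have h2 : boostDenom (-s) c (boost c s x).1 = x.1 * (boostDenom c s x.1)⁻¹ := by
    have h3 : c • boostDenom s c x.1 - s • boostDenom c s x.1 = x.1 := by
      calc c • boostDenom s c x.1 - s • boostDenom c s x.1 = (c ^ 2 - s ^ 2) • x.1 := by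
            rw [boostDenom, boostDenom]
            module
        _ = x.1 := by rw [h, one_smul]
    have := congrArg (· * (boostDenom c s x.1)⁻¹) h3
    simp only [sub_mul, smul_mul_assoc, mul_inv_self hw] at this
    rw [← this, boost]
    simp only [boostDenom]
    module
  have hi := inv_ne_zero' hw
  change (boostDenom (-s) c (boost c s x).1 * (boostDenom c (-s) (boost c s x).1)⁻¹,
    x.2 * (boostDenom c s x.1)⁻¹ * (boostDenom c (-s) (boost c s x).1)⁻¹) = x
  rw [h1, h2, mul_mul_inv _ hi, mul_mul_inv _ hi]

theorem contDiffAt_boost {x : OctPlane} (hw : boostDenom c s x.1 ≠ 0) :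
    ContDiffAt ℝ ∞ (boost c s) x := by
  have hden : ∀ c s : ℝ, ContDiff ℝ ∞ fun y : OctPlane => boostDenom c s y.1 := fun c s =>
    contDiff_const.add (contDiff_fst.const_smul s)
  have hinv : ContDiffAt ℝ ∞ (fun y : OctPlane => (boostDenom c s y.1)⁻¹) x :=
    ContDiffAt.comp (g := fun a : Octonion => a⁻¹) x
      (contDiffOn_inv.contDiffAt (isOpen_ne.mem_nhds hw)) (hden c s).contDiffAt
  have hmul : ∀ f : OctPlane → Octonion, ContDiff ℝ ∞ f →
      ContDiffAt ℝ ∞ (fun y => f y * (boostDenom c s y.1)⁻¹) x := fun f hf =>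
    ContDiffAt.comp (g := fun p : Octonion × Octonion => p.1 * p.2)
      (f := fun y => (f y, (boostDenom c s y.1)⁻¹)) x
      contDiff_mul.contDiffAt (hf.contDiffAt.prodMk hinv)
  exact (hmul (fun y => boostDenom s c y.1) (hden s c)).prodMk (hmul (fun y => y.2) contDiff_snd)

end Boost

/-! ### Metrics read in a preferred chart -/

section Charts

variable {E : Type*} [NormedAddCommGroup E] [NormedSpace ℝ E]
  {M : Type*} [TopologicalSpace M] [ChartedSpace E M]

/-- Tangent vectors are read in the preferred chart of their own base point. By `h` that chart is
the one at `p`, so no transition map intervenes. -/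
theorem hasMFDerivAt_chartAt_symm (p : M) {x : E} (hx : x ∈ (chartAt E p).target)
    (h : chartAt E ((chartAt E p).symm x) = chartAt E p) :
    HasMFDerivAt 𝓘(ℝ, E) 𝓘(ℝ, E) (chartAt E p).symm x (ContinuousLinearMap.id ℝ E) := by
  refine ⟨(chartAt E p).continuousAt_symm hx, ?_⟩
  refine ((hasFDerivAt_id (𝕜 := ℝ) x).congr_of_eventuallyEq ?_).hasFDerivWithinAt
  filter_upwards [(chartAt E p).open_target.mem_nhds hx] with y hy
  simp only [writtenInExtChartAt, Function.comp_apply, extChartAt_model_space_eq_id,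
    PartialEquiv.refl_symm, PartialEquiv.refl_coe, id_eq, extChartAt_coe, h,
    modelWithCornersSelf_coe]
  exact (chartAt E p).right_inv hy

theorem chartMetric_eq
    (g : ∀ q : M, TangentSpace 𝓘(ℝ, E) q →L[ℝ] TangentSpace 𝓘(ℝ, E) q →L[ℝ] ℝ)
    (p : M) {x : E} (hx : x ∈ (chartAt E p).target)
    (h : chartAt E ((chartAt E p).symm x) = chartAt E p) :
    chartMetric g p x = (g ((chartAt E p).symm x) : E →L[ℝ] E →L[ℝ] ℝ) := by
  simp only [chartMetric, (hasMFDerivAt_chartAt_symm p hx h).mfderiv]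
  rfl

end Charts

/-! ### Open subsets of the model space -/

section Opens

open TopologicalSpace

theorem TopologicalSpace.Opens.chartAt_target_model {E : Type*} [TopologicalSpace E] {U : Opens E}
    (p : U) : (chartAt E p).target = U := by
  ext y
  constructor
  · intro hy
    rw [← (chartAt E p).right_inv hy]
    exact ((chartAt E p).symm y).2
  · intro hy
    have : (⟨y, hy⟩ : U) ∈ (chartAt E p).source := mem_chart_source E (⟨y, hy⟩ : U)
    exact (chartAt E p).map_source this

theorem TopologicalSpace.Opens.coe_chartAt_symm_model {E : Type*} [TopologicalSpace E]
    {U : Opens E} (p : U) {y : E} (hy : y ∈ U) : ((chartAt E p).symm y : E) = y := by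
  have : y ∈ (chartAt E p).target := by rwa [Opens.chartAt_target_model]
  exact (chartAt E p).right_inv this

variable {E : Type*} [NormedAddCommGroup E] [NormedSpace ℝ E] {U : Opens E}

theorem TopologicalSpace.Opens.hasMFDerivAt_of_coe_eq {f : U → U} {F : E → E} {F' : E →L[ℝ] E}
    {q : U} (h : ∀ q : U, (f q : E) = F q) (hF : HasFDerivAt F F' q) :
    HasMFDerivAt 𝓘(ℝ, E) 𝓘(ℝ, E) f q F' := by
  constructor
  · rw [Topology.IsInducing.subtypeVal.continuousAt_iff]
    have hc : ContinuousAt (fun q : U => F q) q :=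
      ContinuousAt.comp (g := F) hF.continuousAt continuousAt_subtype_val
    exact hc.congr (Filter.Eventually.of_forall fun q => (h q).symm)
  · refine (hF.congr_of_eventuallyEq ?_).hasFDerivWithinAt
    filter_upwards [U.isOpen.mem_nhds q.2] with y hy
    change (f ((chartAt E q).symm y) : E) = F y
    rw [h, Opens.coe_chartAt_symm_model q hy]

theorem TopologicalSpace.Opens.contMDiff_of_coe_eq {f : U → U} {F : E → E}
    (h : ∀ q : U, (f q : E) = F q) (hF : ∀ x ∈ U, ContDiffAt ℝ ∞ F x) :
    ContMDiff 𝓘(ℝ, E) 𝓘(ℝ, E) ∞ f := by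
  rw [← ContMDiff.subtypeVal_comp_iff]
  intro q
  have : Subtype.val ∘ f = fun q : U => F q := funext h
  rw [this]
  exact contMDiffAt_subtype_iff.2 (hF q q.2).contMDiffAt

theorem TopologicalSpace.Opens.contMDiff_bilinForm_section
    (g : ∀ p : U, TangentSpace 𝓘(ℝ, E) p →L[ℝ] TangentSpace 𝓘(ℝ, E) p →L[ℝ] ℝ)
    {G : E → E →L[ℝ] E →L[ℝ] ℝ} (h : ∀ (p : U) (v w : E), g p v w = G p v w)
    (hG : ∀ x ∈ U, ContDiffAt ℝ ∞ G x) :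
    ContMDiff 𝓘(ℝ, E) (𝓘(ℝ, E).prod 𝓘(ℝ, E →L[ℝ] E →L[ℝ] ℝ)) ∞
      (fun p : U => Bundle.TotalSpace.mk' (E →L[ℝ] E →L[ℝ] ℝ)
        (E := fun p : U =>
          TangentSpace 𝓘(ℝ, E) p →L[ℝ] TangentSpace 𝓘(ℝ, E) p →L[ℝ] ℝ) p (g p)) := by
  intro p
  rw [Bundle.contMDiffAt_section]
  have hGp : ContMDiffAt 𝓘(ℝ, E) 𝓘(ℝ, E →L[ℝ] E →L[ℝ] ℝ) ∞ (fun q : U => G q) p :=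
    contMDiffAt_subtype_iff.2 (hG p p.2).contMDiffAt
  refine hGp.congr_of_eventuallyEq (Filter.Eventually.of_forall fun q => ?_)
  ext v w
  have hq : q ∈ (chartAt E p).source := mem_chart_source E q
  -- All points have the same preferred chart, so the coordinate change of the tangent bundle is
  -- that of a chart with itself.
  have hs : ∀ z : E, (trivializationAt E (TangentSpace 𝓘(ℝ, E)) p).symmL ℝ q z = z := by
    rw [TangentBundle.symmL_trivializationAt_eq_core hq]
    exact (tangentBundleCore 𝓘(ℝ, E) U).coordChange_self (achart E p) q hq
  have hs' : ∀ z : E, (trivializationAt E (TangentSpace 𝓘(ℝ, E)) p).symm q z = z := fun z => by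
    rw [← Bundle.Trivialization.symmL_apply (R := ℝ) _ (by exact hq)]
    exact hs z
  rw [← h]
  simp only [hom_trivializationAt_apply]
  rw [inCoordinates_apply_eq₂ (by exact hq) (by exact hq) (by exact Set.mem_univ q), hs', hs']
  simp

end Opens

/-! ### Composition and inversion of isometries -/

section Isometries

variable {E : Type*} [NormedAddCommGroup E] [NormedSpace ℝ E]
  {M : Type*} [TopologicalSpace M] [ChartedSpace E M]
  {g : ∀ q : M, TangentSpace 𝓘(ℝ, E) q →L[ℝ] TangentSpace 𝓘(ℝ, E) q →L[ℝ] ℝ}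

theorem IsMetricIsometry.trans {f₁ f₂ : M ≃ₘ^∞⟮𝓘(ℝ, E), 𝓘(ℝ, E)⟯ M}
    (h₁ : IsMetricIsometry g f₁) (h₂ : IsMetricIsometry g f₂) :
    IsMetricIsometry g (f₁.trans f₂) := fun q v w => by
  have h := mfderiv_comp q (f₂.mdifferentiable (by simp) (f₁ q)) (f₁.mdifferentiable (by simp) q)
  rw [Diffeomorph.coe_trans, h]
  exact (h₂ _ _ _).trans (h₁ _ _ _)

theorem IsMetricIsometry.symm {f : M ≃ₘ^∞⟮𝓘(ℝ, E), 𝓘(ℝ, E)⟯ M} (h : IsMetricIsometry g f) :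
    IsMetricIsometry g f.symm := fun q v w => by
  have hc := mfderiv_comp q (f.mdifferentiable (by simp) (f.symm q))
    (f.symm.mdifferentiable (by simp) q)
  have hid : f ∘ f.symm = id := funext f.apply_symm_apply
  rw [hid, mfderiv_id] at hc
  have hv : ∀ v : E, mfderiv 𝓘(ℝ, E) 𝓘(ℝ, E) f (f.symm q)
      (mfderiv 𝓘(ℝ, E) 𝓘(ℝ, E) f.symm q v) = v := fun v => (DFunLike.congr_fun hc v).symm
  -- Keeping the vectors in `E` allows the base point to be replaced without transporting them
  -- between tangent spaces.
  have hq : ∀ p, p = q → ∀ v w v' w' : E, v' = v → w' = w → g p v' w' = g q v w := by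
    rintro p rfl v w _ _ rfl rfl
    rfl
  rw [← h]
  exact hq _ (f.apply_symm_apply q) _ _ _ _ (hv v) (hv w)

end Isometries

/-- Supplies the reflection with t = 0 that makes the nonzero coordinate of a point on an axis real:
x = a/|a|. -/
theorem Octonion.exists_mul_eq_norm (a : Octonion) :
    ∃ x : Octonion, ‖x‖ ^ 2 = 1 ∧ star x * a = ‖a‖ • 1 := by
  by_cases ha : a = 0
  · exact ⟨1, norm_sq_one, by simp [ha]⟩
  have h : ‖a‖ ≠ 0 := norm_ne_zero_iff.2 ha
  refine ⟨‖a‖⁻¹ • a, by simp [norm_smul, h], ?_⟩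
  have h1 : star a * a = (‖a‖ ^ 2) • 1 := by simpa using star_mul_mul a 1
  rw [star_smul', smul_mul_assoc, h1, smul_smul]
  congr 1
  field_simp

/-- Octonionic conjugation as a continuous linear map. -/
noncomputable def Octonion.starL : Octonion →L[ℝ] Octonion :=
  LinearMap.toContinuousLinearMap
    { toFun := fun a => star a
      map_add' := star_add'
      map_smul' := star_smul' }

/-- The continuous bilinear forms on `E`. -/
abbrev ContBilinForm (E : Type*) [NormedAddCommGroup E] [NormedSpace ℝ E] : Type _ :=
  E →L[ℝ] E →L[ℝ] ℝ

theorem contDiffAt_smul_add_clm {E F V : Type*} [NormedAddCommGroup E] [NormedSpace ℝ E]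
    [NormedAddCommGroup F] [NormedSpace ℝ F] [NormedAddCommGroup V] [NormedSpace ℝ V]
    {k α β : E → ℝ} {q : E → V} {x : E} (A B : F) (C : V →L[ℝ] F)
       (hk : ContDiffAt ℝ ∞ k x)
    (hα : ContDiffAt ℝ ∞ α x) (hβ : ContDiffAt ℝ ∞ β x) (hq : ContDiffAt ℝ ∞ q x) :
    ContDiffAt ℝ ∞ (fun y => k y • (α y • A + (β y • B + C (q y)))) x :=
  hk.smul ((hα.smul contDiffAt_const).add ((hβ.smul contDiffAt_const).add
    (C.contDiff.contDiffAt.comp x hq)))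

/-- The mixed part of `planeForm`, as a linear function of the octonion. -/
noncomputable def planeFormCross : Octonion →L[ℝ] ContBilinForm OctPlane :=
  LinearMap.toContinuousLinearMap
    { toFun := fun q => planeForm 0 0 q
      map_add' := fun q r => by
        refine ContinuousLinearMap.ext fun X => ContinuousLinearMap.ext fun Y => ?_
        change _ = planeForm 0 0 q X Y + planeForm 0 0 r X Y
        simp only [planeForm_apply, inner_add_left]
        ring
      map_smul' := fun c q => by
        refine ContinuousLinearMap.ext fun X => ContinuousLinearMap.ext fun Y => ?_
        change _ = c * planeForm 0 0 q X Y
        simp only [planeForm_apply, real_inner_smul_left]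
        ring }

theorem planeForm_eq_add (α β : ℝ) (q : Octonion) :
    (planeForm α β q : ContBilinForm OctPlane)
      = α • (planeForm 1 0 0 : ContBilinForm OctPlane)
        + (β • (planeForm 0 1 0 : ContBilinForm OctPlane) + planeFormCross q) := by
  refine ContinuousLinearMap.ext fun X => ContinuousLinearMap.ext fun Y => ?_
  change _ = α * planeForm 1 0 0 X Y + (β * planeForm 0 1 0 X Y + planeForm 0 0 q X Y)
  simp only [planeForm_apply, inner_zero_left]
  ring

/-! ### Transitivity, smoothness and topology of the hyperbolic plane -/

namespace OH2

theorem mem_iff {x : OctPlane} : x ∈ OH2 ↔ ‖x.1‖ ^ 2 + ‖x.2‖ ^ 2 < 1 := Iff.rfl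

theorem exists_isometry {F F' : OctPlane → OctPlane} {D : OctPlane → OctPlane →L[ℝ] OctPlane}
    (hF : ∀ x ∈ OH2, F x ∈ OH2) (hF' : ∀ x ∈ OH2, F' x ∈ OH2)
    (hl : ∀ x ∈ OH2, F' (F x) = x) (hr : ∀ x ∈ OH2, F (F' x) = x)
    (hc : ∀ x ∈ OH2, ContDiffAt ℝ ∞ F x) (hc' : ∀ x ∈ OH2, ContDiffAt ℝ ∞ F' x)
    (hD : ∀ x ∈ OH2, HasFDerivAt F (D x) x)
    (hg : ∀ x ∈ OH2, ∀ X, hypForm (F x) (D x X) (D x X) = hypForm x X X) :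
    ∃ f : OH2 ≃ₘ^∞⟮𝓘(ℝ, OctPlane), 𝓘(ℝ, OctPlane)⟯ OH2,
      IsMetricIsometry OH2.metric f ∧ ∀ p : OH2, (f p : OctPlane) = F p := by
  refine ⟨{ toFun := fun p => ⟨F p, hF p p.2⟩
            invFun := fun p => ⟨F' p, hF' p p.2⟩
            left_inv := fun p => Subtype.ext (hl p p.2)
            right_inv := fun p => Subtype.ext (hr p p.2)
            contMDiff_toFun := TopologicalSpace.Opens.contMDiff_of_coe_eq (fun _ => rfl) hc
            contMDiff_invFun := TopologicalSpace.Opens.contMDiff_of_coe_eq (fun _ => rfl) hc' },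
    fun q v w => ?_, fun p => rfl⟩
  have h : HasMFDerivAt 𝓘(ℝ, OctPlane) 𝓘(ℝ, OctPlane) (fun p : OH2 => (⟨F p, hF p p.2⟩ : OH2)) q
      (D q) := TopologicalSpace.Opens.hasMFDerivAt_of_coe_eq (fun _ => rfl) (hD q q.2)
  change hypForm (F q) (mfderiv _ _ (fun p : OH2 => (⟨F p, hF p p.2⟩ : OH2)) q v)
    (mfderiv _ _ (fun p : OH2 => (⟨F p, hF p p.2⟩ : OH2)) q w) = hypForm q v w
  rw [h.mfderiv]
  exact hypForm_map_map (D q) (hg q q.2) v w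

theorem exists_isometry_spinReflection {t : ℝ} {x : Octonion} (h : t ^ 2 + ‖x‖ ^ 2 = 1) :
    ∃ f : OH2 ≃ₘ^∞⟮𝓘(ℝ, OctPlane), 𝓘(ℝ, OctPlane)⟯ OH2,
      IsMetricIsometry OH2.metric f ∧ ∀ p : OH2, (f p : OctPlane) = spinReflection t x p :=
  have hmem : ∀ y ∈ OH2, spinReflection t x y ∈ OH2 := fun y hy => by
    rwa [mem_iff, norm_sq_spinReflection h]
  exists_isometry (D := fun _ => spinReflection t x) hmem hmem
    (fun _ _ => spinReflection_spinReflection h _) (fun _ _ => spinReflection_spinReflection h _)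
    (fun _ _ => (spinReflection t x).contDiff.contDiffAt)
    (fun _ _ => (spinReflection t x).contDiff.contDiffAt)
    (fun _ _ => (spinReflection t x).hasFDerivAt) (fun y _ X => hypForm_spinReflection h y X)

theorem norm_fst_lt {x : OctPlane} (hx : x ∈ OH2) : ‖x.1‖ ^ 2 < 1 := by
  nlinarith [mem_iff.1 hx, sq_nonneg ‖x.2‖]

theorem boost_mem {c s : ℝ} (h : c ^ 2 - s ^ 2 = 1) {x : OctPlane} (hx : x ∈ OH2) :
    boost c s x ∈ OH2 := by
  have h1 := one_sub_norm_sq_boost h (norm_fst_lt hx)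
  have h2 : 0 < ‖boostDenom c s x.1‖ := norm_pos_iff.2 (boostDenom_ne_zero h (norm_fst_lt hx))
  have h3 : 0 < 1 - ‖x.1‖ ^ 2 - ‖x.2‖ ^ 2 := by linarith [mem_iff.1 hx]
  have h4 : 0 < (‖boostDenom c s x.1‖ ^ 2)⁻¹ * (1 - ‖x.1‖ ^ 2 - ‖x.2‖ ^ 2) := by positivity
  rw [mem_iff]
  linarith

theorem exists_isometry_boost {c s : ℝ} (h : c ^ 2 - s ^ 2 = 1) :
    ∃ f : OH2 ≃ₘ^∞⟮𝓘(ℝ, OctPlane), 𝓘(ℝ, OctPlane)⟯ OH2,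
      IsMetricIsometry OH2.metric f ∧ ∀ p : OH2, (f p : OctPlane) = boost c s p := by
  have h' : c ^ 2 - (-s) ^ 2 = 1 := by rwa [neg_sq]
  have hw : ∀ x ∈ OH2, boostDenom c s x.1 ≠ 0 := fun x hx => boostDenom_ne_zero h (norm_fst_lt hx)
  have hw' : ∀ x ∈ OH2, boostDenom c (-s) x.1 ≠ 0 := fun x hx =>
    boostDenom_ne_zero h' (norm_fst_lt hx)
  refine exists_isometry (F' := boost c (-s)) (D := boostDeriv c s) (fun x hx => boost_mem h hx)
    (fun x hx => boost_mem h' hx) (fun x hx => boost_neg_boost h (hw x hx)) (fun x hx => ?_)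
    (fun x hx => contDiffAt_boost (hw x hx)) (fun x hx => contDiffAt_boost (hw' x hx))
    (fun x hx => hasFDerivAt_boost (hw x hx)) (fun x hx X => hypForm_boost h hx X)
  simpa using boost_neg_boost h' (hw' x hx)

theorem exists_isometry_origin (p : OH2) :
    ∃ f : OH2 ≃ₘ^∞⟮𝓘(ℝ, OctPlane), 𝓘(ℝ, OctPlane)⟯ OH2,
      IsMetricIsometry OH2.metric f ∧ f p = OH2.origin := by
  obtain ⟨t, x, h1, h2⟩ := exists_spinReflection (p : OctPlane)
  obtain ⟨f₁, hf₁, hp₁⟩ := exists_isometry_spinReflection h1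
  have hp2 : (f₁ p : OctPlane).2 = 0 := by rw [hp₁, h2]
  obtain ⟨y, hy, hy'⟩ := exists_mul_eq_norm (f₁ p : OctPlane).1
  -- With t = 0 the first reflection sends (a, 0) to (0, ȳ a) = (0, R), and the second swaps the two
  -- axes.
  obtain ⟨f₂, hf₂, hp₂⟩ := exists_isometry_spinReflection (t := 0) (x := y) (by simp [hy])
  obtain ⟨f₃, hf₃, hp₃⟩ := exists_isometry_spinReflection (t := 0) (x := 1) (by simp [norm_sq_one])
  set R := ‖(f₁ p : OctPlane).1‖ with hR
  have hR1 : R ^ 2 < 1 := norm_fst_lt (f₁ p).2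
  have hval : (f₃ (f₂ (f₁ p)) : OctPlane) = (R • 1, 0) := by
    rw [hp₃, hp₂, spinReflection_apply, spinReflection_apply, hp2]
    simp [hy', hR]
  have hs : 0 < √(1 - R ^ 2) := Real.sqrt_pos.2 (by linarith)
  have hs2 : √(1 - R ^ 2) ^ 2 = 1 - R ^ 2 := Real.sq_sqrt (by linarith)
  -- The choice s = -R c makes the numerator s + c R vanish, and c² - s² = 1 then forces c² = 1/(1 -
  -- R²).
  obtain ⟨f₄, hf₄, hp₄⟩ := exists_isometry_boost (c := (√(1 - R ^ 2))⁻¹)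
    (s := -R * (√(1 - R ^ 2))⁻¹) (by
      have : 1 - R ^ 2 ≠ 0 := by linarith
      rw [mul_pow, inv_pow, hs2]
      field_simp)
  refine ⟨((f₁.trans f₂).trans f₃).trans f₄, ((hf₁.trans hf₂).trans hf₃).trans hf₄, ?_⟩
  refine Subtype.ext ((hp₄ _).trans ?_)
  change boost _ _ (f₃ (f₂ (f₁ p)) : OctPlane) = (0, 0)
  rw [hval, boost]
  have : boostDenom (-R * (√(1 - R ^ 2))⁻¹) (√(1 - R ^ 2))⁻¹ (R • 1) = 0 := by
    rw [boostDenom]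
    module
  simp only [this, zero_mul]

theorem isHomogeneousMetric : IsHomogeneousMetric OH2.metric := fun p q => by
  obtain ⟨f, hf, hp⟩ := exists_isometry_origin p
  obtain ⟨k, hk, hq⟩ := exists_isometry_origin q
  refine ⟨f.trans k.symm, hf.trans hk.symm, ?_⟩
  rw [Diffeomorph.coe_trans, Function.comp_apply, hp, ← hq, k.symm_apply_apply]

theorem convex : Convex ℝ (OH2 : Set OctPlane) := by
  have h : ConvexOn ℝ Set.univ fun x : OctPlane => ‖x.1‖ ^ 2 + ‖x.2‖ ^ 2 := by
    have hsq : ConvexOn ℝ Set.univ fun a : Octonion => ‖a‖ ^ 2 :=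
      convexOn_univ_norm.pow (fun _ _ => norm_nonneg _) 2
    exact (hsq.comp_linearMap (LinearMap.fst ℝ Octonion Octonion)).add
      (hsq.comp_linearMap (LinearMap.snd ℝ Octonion Octonion))
  have h' := h.convex_lt 1
  simp only [Set.mem_univ, true_and] at h'
  exact h'

theorem contDiffAt_hypForm {x : OctPlane} (hx : x ∈ OH2) :
    ContDiffAt ℝ ∞ (F := ContBilinForm OctPlane) hypForm x := by
  have h1 : ContDiff ℝ ∞ fun y : OctPlane => ‖y.1‖ ^ 2 := (contDiff_norm_sq ℝ).comp contDiff_fst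
  have h2 : ContDiff ℝ ∞ fun y : OctPlane => ‖y.2‖ ^ 2 := (contDiff_norm_sq ℝ).comp contDiff_snd
  have hq : ContDiff ℝ ∞ fun y : OctPlane => mulL y.1 (starL y.2) := by fun_prop
  have hk : ContDiffAt ℝ ∞ (fun y : OctPlane => ((1 - ‖y.1‖ ^ 2 - ‖y.2‖ ^ 2) ^ 2)⁻¹) x := by
    refine ContDiffAt.inv (((contDiff_const.sub h1).sub h2).pow 2).contDiffAt ?_
    have : 0 < 1 - ‖x.1‖ ^ 2 - ‖x.2‖ ^ 2 := by linarith [mem_iff.1 hx]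
    positivity
  refine (contDiffAt_smul_add_clm (F := ContBilinForm OctPlane) (planeForm 1 0 0)
    (planeForm 0 1 0) planeFormCross hk
    ((contDiff_const (c := 1)).sub h2).contDiffAt ((contDiff_const (c := 1)).sub h1).contDiffAt
    hq.contDiffAt).congr_of_eventuallyEq (Filter.Eventually.of_forall fun y => ?_)
  exact congrArg (((1 - ‖y.1‖ ^ 2 - ‖y.2‖ ^ 2) ^ 2)⁻¹ • ·) (planeForm_eq_add _ _ _)

theorem exists_riemannianMetric :
    ∃ g : Bundle.ContMDiffRiemannianMetric 𝓘(ℝ, OctPlane) ∞ OctPlane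
        (fun p : OH2 => TangentSpace 𝓘(ℝ, OctPlane) p), ∀ p, g.inner p = OH2.metric p :=
  ⟨{ inner := OH2.metric
     symm := fun p v w => hypForm_comm p v w
     pos := fun p v hv => hypForm_pos p.2 hv
     isVonNBounded := fun p => by
       refine (NormedSpace.isVonNBounded_ball ℝ OctPlane 1).subset fun v hv => ?_
       -- The metric dominates |du|² + |dv|², so its unit ball lies in that of `OctPlane`, whose
       -- norm is the maximum norm.
       have h := (norm_sq_le_hypForm p.2 v).trans_lt hv
       refine (mem_ball_zero_iff (E := OctPlane)).2 (max_lt_iff.2 ?_)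
       constructor <;> nlinarith [norm_nonneg v.1, norm_nonneg v.2]
     contMDiff := TopologicalSpace.Opens.contMDiff_bilinForm_section OH2.metric
       (fun _ _ _ => rfl) fun x hx => contDiffAt_hypForm hx }, fun _ => rfl⟩

theorem finrank_octPlane : Module.finrank ℝ OctPlane = 16 := by
  have h : Module.finrank ℝ Octonion = 8 := by
    have : Module.finrank ℝ (WithLp 2 (Quaternion ℝ × Quaternion ℝ)) = 8 := by
      rw [(WithLp.linearEquiv 2 ℝ (Quaternion ℝ × Quaternion ℝ)).finrank_eq,
        Module.finrank_prod, Quaternion.finrank_eq_four]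
    exact this
  rw [Module.finrank_prod, h]

theorem simplyConnectedSpace : SimplyConnectedSpace OH2 := by
  have : ContractibleSpace OH2 := convex.contractibleSpace ⟨_, OH2.origin.2⟩
  exact SimplyConnectedSpace.ofContractible OH2

end OH2

/-! ### Derivatives of (1 + εN)⁻² (P + εQ) -/

section ConformalQuadratic

set_option maxSynthPendingDepth 3

variable {E F : Type*} [NormedAddCommGroup E] [NormedSpace ℝ E] [NormedAddCommGroup F]
  [NormedSpace ℝ F] {N : E →L[ℝ] E →L[ℝ] ℝ} {Q : E →L[ℝ] E →L[ℝ] F}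

theorem hasFDerivAt_apply_self (hQ : ∀ x y, Q x y = Q y x) (x : E) :
    HasFDerivAt (fun y => Q y y) ((2 : ℝ) • Q x) x := by
  refine (Q.hasFDerivAt_of_bilinear (hasFDerivAt_id x) (hasFDerivAt_id x)).congr_fderiv
    (ContinuousLinearMap.ext fun h => ?_)
  simp [ContinuousLinearMap.precompR, ContinuousLinearMap.precompL, hQ h x, two_smul]

/-- Needed near the origin and not only at it, because the result is differentiated once more. -/
theorem hasFDerivAt_conformal_quadratic (hN : ∀ x y, N x y = N y x) (hQ : ∀ x y, Q x y = Q y x)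
    (P : F) (ε : ℝ) {x : E} (hx : 1 + ε * N x x ≠ 0) :
    HasFDerivAt (fun y => ((1 + ε * N y y) ^ 2)⁻¹ • (P + ε • Q y y))
      ((-4 * ε * ((1 + ε * N x x) ^ 3)⁻¹) •
          ContinuousLinearMap.smulRightL ℝ E F (N x) (P + ε • Q x x)
        + (2 * ε * ((1 + ε * N x x) ^ 2)⁻¹) • Q x) x := by
  have h1 : HasFDerivAt (fun y => 1 + ε * N y y) _ x :=
    ((hasFDerivAt_apply_self hN x).const_mul ε).const_add 1
  have h2 := (hasDerivAt_inv (pow_ne_zero 2 hx)).comp_hasFDerivAt x (h1.pow 2)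
  have h3 : HasFDerivAt (fun y => P + ε • Q y y) _ x :=
    ((hasFDerivAt_apply_self hQ x).const_smul ε).const_add P
  refine (h2.smul h3).congr_fderiv (ContinuousLinearMap.ext fun h => ?_)
  simp [smul_smul, -smul_add]
  rw [add_comm]
  congr 2
  · field_simp
    congr 1
    ring
  · ring

/-- The powers of 1 + εN and the factor P + εQ have zero derivative at 0, so only the linear factors
`N x` and `Q x` contribute. -/
theorem hasFDerivAt_fderiv_conformal_quadratic (hN : ∀ x y, N x y = N y x)
    (hQ : ∀ x y, Q x y = Q y x) (P : F) (ε : ℝ) :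
    HasFDerivAt (fderiv ℝ fun y => ((1 + ε * N y y) ^ 2)⁻¹ • (P + ε • Q y y))
      ((-4 * ε) • ((ContinuousLinearMap.smulRightL ℝ E F).flip P).comp N + (2 * ε) • Q) 0 := by
  have hN0 : HasFDerivAt (fun y => 1 + ε * N y y) (0 : E →L[ℝ] ℝ) 0 := by
    refine (((hasFDerivAt_apply_self hN 0).const_mul ε).const_add 1).congr_fderiv ?_
    simp
  have hQ0 : HasFDerivAt (fun y => P + ε • Q y y) (0 : E →L[ℝ] F) 0 := by
    refine (((hasFDerivAt_apply_self hQ 0).const_smul ε).const_add P).congr_fderiv ?_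
    simp
  have hinv : ∀ (c : ℝ) (n : ℕ),
      HasFDerivAt (fun y => c * ((1 + ε * N y y) ^ n)⁻¹) (0 : E →L[ℝ] ℝ) 0 := fun c n => by
    refine (((hasDerivAt_inv (by simp)).comp_hasFDerivAt 0 (hN0.pow n)).const_mul c).congr_fderiv ?_
    simp
  have hsm := (ContinuousLinearMap.smulRightL ℝ E F).hasFDerivAt_of_bilinear
    (N.hasFDerivAt (x := 0)) hQ0
  refine HasFDerivAt.congr_of_eventuallyEq (((hinv (-4 * ε) 3).smul hsm).add
    ((hinv (2 * ε) 2).smul (Q.hasFDerivAt (x := 0)))) ?_ |>.congr_fderiv ?_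
  · have : ∀ᶠ y in 𝓝 (0 : E), 1 + ε * N y y ≠ 0 := by
      refine hN0.continuousAt.eventually_ne ?_
      simp
    filter_upwards [this] with y hy
    exact (hasFDerivAt_conformal_quadratic hN hQ P ε hy).fderiv
  · refine ContinuousLinearMap.ext fun h => ContinuousLinearMap.ext fun k => ?_
    simp [ContinuousLinearMap.precompR, ContinuousLinearMap.precompL]

theorem hasFDerivAt_conformal_quadratic_zero (hN : ∀ x y, N x y = N y x)
    (hQ : ∀ x y, Q x y = Q y x) (P : F) (ε : ℝ) :
    HasFDerivAt (𝕜 := ℝ) (fun y => ((1 + ε * N y y) ^ 2)⁻¹ • (P + ε • Q y y)) 0 0 := by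
  refine (hasFDerivAt_conformal_quadratic hN hQ P ε (x := 0) (by simp)).congr_fderiv ?_
  refine ContinuousLinearMap.ext fun h => ?_
  simp

end ConformalQuadratic

/-! ### Curvature at a critical point of the metric coefficients -/

section Curvature

set_option maxSynthPendingDepth 3

variable {E : Type*} [NormedAddCommGroup E] [NormedSpace ℝ E]

/-- The Christoffel symbols of the first kind as a linear function of the derivative of the
metric. -/
noncomputable def christoffelFirstL (a b : E) : (E →L[ℝ] E →L[ℝ] E →L[ℝ] ℝ) →L[ℝ] E →L[ℝ] ℝ :=
  (1 / 2 : ℝ) •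
    ((ContinuousLinearMap.apply ℝ (E →L[ℝ] ℝ) b).comp
        (ContinuousLinearMap.apply ℝ (E →L[ℝ] E →L[ℝ] ℝ) a)
      + (ContinuousLinearMap.apply ℝ (E →L[ℝ] ℝ) a).comp
        (ContinuousLinearMap.apply ℝ (E →L[ℝ] E →L[ℝ] ℝ) b)
      - (ContinuousLinearMap.apply ℝ (E →L[ℝ] ℝ) b).comp
          ((ContinuousLinearMap.flipₗᵢ ℝ E E ℝ).toContinuousLinearEquiv.toContinuousLinearMap.comp
            ((ContinuousLinearMap.apply ℝ (E →L[ℝ] E →L[ℝ] ℝ) a).comp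
              (ContinuousLinearMap.flipₗᵢ ℝ E E
                (E →L[ℝ] ℝ)).toContinuousLinearEquiv.toContinuousLinearMap)))

theorem christoffelFirstL_fderiv (G : E → E →L[ℝ] E →L[ℝ] ℝ) (x a b : E) :
    christoffelFirstL a b (fderiv ℝ G x) = christoffelFirst G x a b := rfl

theorem christoffelFirstL_apply (T : E →L[ℝ] E →L[ℝ] E →L[ℝ] ℝ) (a b c : E) :
    christoffelFirstL a b T c = 1 / 2 * (T a b c + T b a c - T c a b) := rfl

variable [CompleteSpace E] {G : E → E →L[ℝ] E →L[ℝ] ℝ} {x : E} {e : E ≃L[ℝ] E →L[ℝ] ℝ}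
  {H : E →L[ℝ] E →L[ℝ] E →L[ℝ] E →L[ℝ] ℝ}

/-- The symbols of the first kind vanish at `x`, so the derivative of the inverse metric drops out
of the product rule and need not be computed. -/
theorem hasFDerivAt_christoffel (he : G x = e) (h0 : HasFDerivAt (𝕜 := ℝ) G 0 x)
    (h1 : HasFDerivAt (fderiv ℝ G) H x) (a b : E) :
    HasFDerivAt (fun y => christoffel G y a b)
      ((e.symm : (E →L[ℝ] ℝ) →L[ℝ] E).comp ((christoffelFirstL a b).comp H)) x := by
  have hinv : DifferentiableAt ℝ (fun y => (G y).inverse) x := by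
    have := (contDiffAt_map_inverse (𝕜 := ℝ) (n := 1) e).differentiableAt (by simp)
    rw [← he] at this
    exact this.comp x h0.differentiableAt
  have hcf : HasFDerivAt (fun y => christoffelFirst G y a b) ((christoffelFirstL a b).comp H) x :=
    (christoffelFirstL a b).hasFDerivAt.comp x h1
  have hcf0 : christoffelFirst G x a b = 0 := by
    rw [← christoffelFirstL_fderiv, h0.fderiv, map_zero]
  refine (hinv.hasFDerivAt.clm_apply hcf).congr_fderiv ?_
  rw [hcf0, map_zero, add_zero, he, ContinuousLinearMap.inverse_equiv]

/-- The curvature at a critical point of the metric coefficients, in terms of their second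
derivatives. -/
theorem apply_coordCurvature (he : G x = e) (h0 : HasFDerivAt (𝕜 := ℝ) G 0 x)
    (h1 : HasFDerivAt (fderiv ℝ G) H x) (hH : ∀ a b, H a b = H b a) (a b c d : E) :
    G x (coordCurvature G x a b c) d
      = 1 / 2 * (H b c a d - H b d a c - H a c b d + H a d b c) := by
  have hz : ∀ a b, christoffel G x a b = 0 := fun a b => by
    rw [christoffel, ← christoffelFirstL_fderiv, h0.fderiv, map_zero, map_zero]
  rw [coordCurvature, hz a, hz b c, hz a, hz b, (hasFDerivAt_christoffel he h0 h1 a c).fderiv,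
    (hasFDerivAt_christoffel he h0 h1 b c).fderiv, he, add_zero, sub_zero, map_sub]
  simp only [ContinuousLinearMap.comp_apply, ContinuousLinearEquiv.coe_coe,
    ContinuousLinearEquiv.apply_symm_apply, sub_apply, christoffelFirstL_apply]
  -- Symmetry of the Hessian cancels the terms differentiated along both `a` and `b`.
  rw [hH a b]
  ring

/-- Ensures that the `inverse` in `christoffel` is the genuine inverse and not its default value 0.
-/
theorem ContinuousLinearMap.exists_equiv_of_anisotropic {E : Type*} [NormedAddCommGroup E]
    [NormedSpace ℝ E] [FiniteDimensional ℝ E] (B : E →L[ℝ] E →L[ℝ] ℝ)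
    (hB : ∀ v, B v v = 0 → v = 0) : ∃ e : E ≃L[ℝ] E →L[ℝ] ℝ, B = e := by
  have hinj : Function.Injective (B : E →ₗ[ℝ] E →L[ℝ] ℝ) := by
    refine (injective_iff_map_eq_zero _).2 fun v hv => hB v ?_
    have : B v = 0 := hv
    rw [this]
    rfl
  have hfin : FiniteDimensional ℝ (E →L[ℝ] ℝ) :=
    (LinearMap.toContinuousLinearMap (𝕜 := ℝ) (E := E) (F' := ℝ)).finiteDimensional
  have hdim : Module.finrank ℝ E = Module.finrank ℝ (E →L[ℝ] ℝ) := by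
    rw [← (LinearMap.toContinuousLinearMap (𝕜 := ℝ) (E := E) (F' := ℝ)).finrank_eq]
    exact (Subspace.dual_finrank_eq).symm
  exact ⟨((B : E →ₗ[ℝ] E →L[ℝ] ℝ).linearEquivOfInjective hinj hdim).toContinuousLinearEquiv, rfl⟩

end Curvature

/-! ### The common family of the two metrics and its Hessian -/

/-- The continuous bilinear maps from `E` to `F`. -/
abbrev ContBilinMap (E F : Type*) [NormedAddCommGroup E] [NormedSpace ℝ E] [NormedAddCommGroup F]
    [NormedSpace ℝ F] : Type _ :=
  E →L[ℝ] E →L[ℝ] F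

/-- The polarization of the quadratic part of `planeForm (1 + |v|²) (1 + |u|²) (-(u v̄))`. -/
noncomputable def planeQuad : ContBilinMap OctPlane (ContBilinForm OctPlane) :=
  (LinearMap.mk₂ ℝ (fun x y : OctPlane =>
      (planeForm (inner ℝ x.2 y.2) (inner ℝ x.1 y.1)
        ((-1 / 2 : ℝ) • (x.1 * star y.2 + y.1 * star x.2)) : ContBilinForm OctPlane))
    (fun x x' y => by
      refine ContinuousLinearMap.ext fun X => ContinuousLinearMap.ext fun Y => ?_
      change _ = planeForm _ _ _ X Y + planeForm _ _ _ X Y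
      simp only [planeForm_apply, Prod.fst_add, Prod.snd_add, inner_add_left, star_add', add_mul,
        mul_add, real_inner_smul_left]
      ring)
    (fun r x y => by
      refine ContinuousLinearMap.ext fun X => ContinuousLinearMap.ext fun Y => ?_
      change _ = r * planeForm _ _ _ X Y
      simp only [planeForm_apply, Prod.smul_fst, Prod.smul_snd, real_inner_smul_left, star_smul',
        smul_mul_assoc, mul_smul_comm, inner_add_left]
      ring)
    (fun x y y' => by
      refine ContinuousLinearMap.ext fun X => ContinuousLinearMap.ext fun Y => ?_
      change _ = planeForm _ _ _ X Y + planeForm _ _ _ X Y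
      simp only [planeForm_apply, Prod.fst_add, Prod.snd_add, inner_add_left, inner_add_right,
        star_add', add_mul, mul_add, real_inner_smul_left]
      ring)
    (fun r x y => by
      refine ContinuousLinearMap.ext fun X => ContinuousLinearMap.ext fun Y => ?_
      change _ = r * planeForm _ _ _ X Y
      simp only [planeForm_apply, Prod.smul_fst, Prod.smul_snd, real_inner_smul_left,
        real_inner_smul_right, star_smul', smul_mul_assoc, mul_smul_comm, inner_add_left]
      ring)).toContinuousBilinearMap

theorem planeQuad_apply (x y : OctPlane) :
    planeQuad x y = planeForm (inner ℝ x.2 y.2) (inner ℝ x.1 y.1)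
        ((-1 / 2 : ℝ) • (x.1 * star y.2 + y.1 * star x.2)) := rfl

theorem planeQuad_comm (x y : OctPlane) : planeQuad x y = planeQuad y x := by
  rw [planeQuad_apply, planeQuad_apply, real_inner_comm, real_inner_comm y.1, add_comm]

/-- The metric whose values for `ε = 1, -1` are the metrics of the projective and of the hyperbolic
plane in affine coordinates. -/
noncomputable def affineForm (ε : ℝ) (x : OctPlane) : ContBilinForm OctPlane :=
  ((1 + ε * planeForm 1 1 0 x x) ^ 2)⁻¹ • (planeForm 1 1 0 + ε • planeQuad x x)

theorem planeForm_one_one_self (x : OctPlane) :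
    planeForm 1 1 0 x x = ‖x.1‖ ^ 2 + ‖x.2‖ ^ 2 := by
  simp [planeForm_apply]

theorem affineForm_apply (ε : ℝ) (x : OctPlane) :
    affineForm ε x = (((1 + ε * (‖x.1‖ ^ 2 + ‖x.2‖ ^ 2)) ^ 2)⁻¹ •
      planeForm (1 + ε * ‖x.2‖ ^ 2) (1 + ε * ‖x.1‖ ^ 2) (-(ε • (x.1 * star x.2)))) := by
  rw [affineForm, planeForm_one_one_self]
  refine congrArg (((1 + ε * (‖x.1‖ ^ 2 + ‖x.2‖ ^ 2)) ^ 2)⁻¹ • ·) ?_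
  refine ContinuousLinearMap.ext fun X => ContinuousLinearMap.ext fun Y => ?_
  change planeForm 1 1 0 X Y + ε * planeForm _ _ _ X Y = _
  simp only [planeForm_apply, inner_zero_left, real_inner_smul_left, inner_neg_left,
    inner_add_left, real_inner_self_eq_norm_sq]
  ring

theorem affineForm_one : affineForm 1 = projForm := by
  funext x
  rw [affineForm_apply, projForm]
  simp only [one_mul, one_smul, add_assoc]

theorem affineForm_neg_one : affineForm (-1) = hypForm := by
  funext x
  rw [affineForm_apply, hypForm]
  simp only [neg_mul, one_mul, neg_smul, one_smul, neg_neg, ← sub_eq_add_neg, sub_sub]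

theorem affineForm_zero (ε : ℝ) : affineForm ε 0 = planeForm 1 1 0 := by
  rw [affineForm_apply]
  simp

/-- The curvature tensor of the octonionic projective plane at `[1, 0, 0]`. -/
noncomputable def planeCurvature (X Y Z W : OctPlane) : ℝ :=
  4 * inner ℝ X.1 Z.1 * inner ℝ Y.1 W.1 - 4 * inner ℝ Y.1 Z.1 * inner ℝ X.1 W.1
    + 4 * inner ℝ X.2 Z.2 * inner ℝ Y.2 W.2 - 4 * inner ℝ Y.2 Z.2 * inner ℝ X.2 W.2
    - inner ℝ (Z.1 * star Y.2) (W.1 * star X.2) + inner ℝ (Z.1 * star X.2) (W.1 * star Y.2)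
    - inner ℝ (Y.1 * star Z.2) (X.1 * star W.2) + inner ℝ (X.1 * star Z.2) (Y.1 * star W.2)
    - inner ℝ (X.1 * star Y.2 - Y.1 * star X.2) (W.1 * star Z.2 - Z.1 * star W.2)

/-- The second derivative of `affineForm ε` at the origin, divided by `ε`. -/
noncomputable def affineHess (x y z w : OctPlane) : ℝ :=
  -4 * planeForm 1 1 0 x y * planeForm 1 1 0 z w + 2 * planeQuad x y z w

/-- The Hessian contains products such as ⟨c, g⟩⟨f, b⟩, and the target only inner products of
octonionic products in their place. Four instances of the exchange identity convert one into the
other. -/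
theorem affineHess_alternation (X Y Z W : OctPlane) :
    1 / 2 * (affineHess Y Z X W - affineHess Y W X Z - affineHess X Z Y W + affineHess X W Y Z)
      = planeCurvature X Y Z W := by
  obtain ⟨a, b⟩ := X
  obtain ⟨c, d⟩ := Y
  obtain ⟨e, f⟩ := Z
  obtain ⟨g, h⟩ := W
  have e1 := inner_mul_star_add_exchange c f g b
  have e2 := inner_mul_star_add_exchange a h e d
  have e3 := inner_mul_star_add_exchange c h e b
  have e4 := inner_mul_star_add_exchange a f g d
  simp only [affineHess, planeQuad_apply, planeForm_apply, planeCurvature, inner_zero_left,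
    real_inner_smul_left, inner_add_left, inner_sub_left, inner_sub_right]
  simp only [real_inner_comm (c * star f) (g * star b),
    real_inner_comm (e * star d) (g * star b), real_inner_comm (c * star f) (a * star h),
    real_inner_comm (e * star d) (a * star h), real_inner_comm (c * star h) (e * star b),
    real_inner_comm (g * star d) (e * star b), real_inner_comm (c * star h) (a * star f),
    real_inner_comm (g * star d) (a * star f), real_inner_comm b f, real_inner_comm b h,
    real_inner_comm d f, real_inner_comm d h] at *
  linear_combination -e1 - e2 + e3 + e4

theorem planeForm_one_one_anisotropic (v : OctPlane) (h : planeForm 1 1 0 v v = 0) : v = 0 := by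
  rw [planeForm_one_one_self] at h
  have h1 := sq_nonneg ‖v.1‖
  have h2 := sq_nonneg ‖v.2‖
  exact Prod.ext (by simpa using (by linarith : ‖v.1‖ ^ 2 = 0))
    (by simpa using (by linarith : ‖v.2‖ ^ 2 = 0))

/-! ### The curvature tensors at the two base points -/

theorem riemannCurvature_eq_planeCurvature {M : Type*} [TopologicalSpace M]
    [ChartedSpace OctPlane M]
    (g : ∀ q : M, TangentSpace 𝓘(ℝ, OctPlane) q →L[ℝ] TangentSpace 𝓘(ℝ, OctPlane) q →L[ℝ] ℝ)
    (p : M) (ε : ℝ) (hp : chartAt OctPlane p p = 0)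
    (hg : ∀ᶠ x in 𝓝 (0 : OctPlane), chartMetric g p x = affineForm ε x)
    (hgp : ∀ v w : OctPlane, g p v w = planeForm 1 1 0 v w) (X Y Z W : OctPlane) :
    riemannCurvature g p X Y Z W = ε * planeCurvature X Y Z W := by
  obtain ⟨e, he⟩ := ContinuousLinearMap.exists_equiv_of_anisotropic (E := OctPlane)
    (planeForm 1 1 0) planeForm_one_one_anisotropic
  have hG : chartMetric g p 0 = planeForm 1 1 0 := hg.self_of_nhds.trans (affineForm_zero ε)
  have h0 := (hasFDerivAt_conformal_quadratic_zero (E := OctPlane) (F := ContBilinForm OctPlane)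
    (N := planeForm 1 1 0) (Q := planeQuad) (planeForm_comm 1 1 0) planeQuad_comm
    (planeForm 1 1 0) ε).congr_of_eventuallyEq hg
  have h1 := (hasFDerivAt_fderiv_conformal_quadratic (E := OctPlane) (F := ContBilinForm OctPlane)
    (N := planeForm 1 1 0) (Q := planeQuad) (planeForm_comm 1 1 0) planeQuad_comm
    (planeForm 1 1 0) ε).congr_of_eventuallyEq
    (Filter.EventuallyEq.fderiv (𝕜 := ℝ) (F := ContBilinForm OctPlane) hg)
  have hcurv := apply_coordCurvature (E := OctPlane) (hG.trans he) h0 h1 (fun a b => by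
    refine ContinuousLinearMap.ext fun v => ContinuousLinearMap.ext fun w => ?_
    change (-4 * ε) * (planeForm 1 1 0 a b * planeForm 1 1 0 v w) + (2 * ε) * planeQuad a b v w
      = (-4 * ε) * (planeForm 1 1 0 b a * planeForm 1 1 0 v w) + (2 * ε) * planeQuad b a v w
    rw [planeForm_comm _ _ _ a b, planeQuad_comm]) X Y Z W
  have hH : ∀ a b v w : OctPlane,
      (-4 * ε) * (planeForm 1 1 0 a b * planeForm 1 1 0 v w) + (2 * ε) * planeQuad a b v w
        = ε * affineHess a b v w := fun a b v w => by
    rw [affineHess]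
    ring
  refine (hgp (coordCurvature (E := OctPlane) (chartMetric g p) (chartAt OctPlane p p) X Y Z)
    W).trans ?_
  rw [hp]
  rw [hG] at hcurv
  refine hcurv.trans ?_
  change 1 / 2 *
    (((-4 * ε) * (planeForm 1 1 0 Y Z * planeForm 1 1 0 X W) + (2 * ε) * planeQuad Y Z X W)
      - ((-4 * ε) * (planeForm 1 1 0 Y W * planeForm 1 1 0 X Z) + (2 * ε) * planeQuad Y W X Z)
      - ((-4 * ε) * (planeForm 1 1 0 X Z * planeForm 1 1 0 Y W) + (2 * ε) * planeQuad X Z Y W)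
      + ((-4 * ε) * (planeForm 1 1 0 X W * planeForm 1 1 0 Y Z) + (2 * ε) * planeQuad X W Y Z)) = _
  rw [hH, hH, hH, hH, ← affineHess_alternation]
  ring

theorem OH2.riemannCurvature_origin (X Y Z W : OctPlane) :
    riemannCurvature OH2.metric OH2.origin X Y Z W = -planeCurvature X Y Z W := by
  rw [riemannCurvature_eq_planeCurvature OH2.metric OH2.origin (-1) rfl ?_ ?_, neg_one_mul]
  · filter_upwards [OH2.isOpen.mem_nhds OH2.origin.2] with x hx
    rw [chartMetric_eq OH2.metric OH2.origin
      (by rwa [TopologicalSpace.Opens.chartAt_target_model]) rfl, affineForm_neg_one]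
    exact congrArg hypForm (TopologicalSpace.Opens.coe_chartAt_symm_model OH2.origin hx)
  · intro v w
    change hypForm 0 v w = _
    rw [← affineForm_neg_one, affineForm_zero]

/-- The index 0 is tried first in `chartIndex`, so the preferred chart is constant on the whole
affine piece, as `chartMetric_eq` requires. -/
theorem OP2.chartAt_param_zero (x : OctPlane) : chartAt OctPlane (OP2.param 0 x) = OP2.chart 0 := by
  change OP2.chart (OP2.chartIndex (OP2.param 0 x)) = OP2.chart 0
  rw [OP2.chartIndex, if_pos ⟨x, rfl⟩]

theorem OP2.chart_param (i : Fin 3) (x : OctPlane) : OP2.chart i (OP2.param i x) = x :=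
  (OP2.isOpenEmbedding_param i).toOpenPartialHomeomorph_left_inv (OP2.param i)

theorem OP2.metric_param_zero (x v w : OctPlane) :
    OP2.metric (OP2.param 0 x) v w = projForm x v w := by
  change projForm (chartAt OctPlane (OP2.param 0 x) (OP2.param 0 x)) v w = _
  rw [OP2.chartAt_param_zero, OP2.chart_param]

theorem OP2.riemannCurvature_basePoint (X Y Z W : OctPlane) :
    riemannCurvature OP2.metric OP2.basePoint X Y Z W = planeCurvature X Y Z W := by
  have hc : chartAt OctPlane OP2.basePoint = OP2.chart 0 := OP2.chartAt_param_zero _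
  rw [riemannCurvature_eq_planeCurvature OP2.metric OP2.basePoint 1 ?_ ?_ ?_, one_mul]
  · rw [hc]
    exact OP2.chart_param 0 _
  · refine Filter.Eventually.of_forall fun x => ?_
    rw [chartMetric_eq OP2.metric OP2.basePoint (by rw [hc]; exact Set.mem_univ x)
      (by rw [hc]; exact OP2.chartAt_param_zero x), affineForm_one]
    refine ContinuousLinearMap.ext fun v => ContinuousLinearMap.ext fun w => ?_
    have : (chartAt OctPlane OP2.basePoint).symm x = OP2.param 0 x := by rw [hc]; rfl
    rw [this]
    exact OP2.metric_param_zero x v w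
  · intro v w
    refine (OP2.metric_param_zero _ v w).trans ?_
    rw [← affineForm_one]
    exact congrArg (fun B => B v w) (affineForm_zero 1)

theorem mainTheorem11 :
    -- `𝕆H²` is a smooth 16-dimensional simply connected manifold
    (Module.finrank ℝ OctPlane = 16 ∧ IsManifold 𝓘(ℝ, OctPlane) ∞ OH2 ∧ T2Space OH2 ∧
      SecondCountableTopology OH2 ∧ SimplyConnectedSpace OH2) ∧
    -- its metric is a smooth Riemannian metric
    (∃ g : Bundle.ContMDiffRiemannianMetric 𝓘(ℝ, OctPlane) ∞ OctPlane
        (fun p : OH2 => TangentSpace 𝓘(ℝ, OctPlane) p), ∀ p, g.inner p = OH2.metric p) ∧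
    -- its isometry group acts transitively
    IsHomogeneousMetric OH2.metric ∧
    -- its curvature at the origin is the negative of that of `𝕆P²` at `[1, 0, 0]`
    (∀ X Y Z W : OctPlane,
      riemannCurvature OH2.metric OH2.origin X Y Z W
        = -riemannCurvature OP2.metric OP2.basePoint X Y Z W) ∧
    -- and the latter is given explicitly
    (∀ a b c d e f g h : Octonion,
      riemannCurvature OP2.metric OP2.basePoint (a, b) (c, d) (e, f) (g, h)
        = 4 * inner ℝ a e * inner ℝ c g - 4 * inner ℝ c e * inner ℝ a g
          + 4 * inner ℝ b f * inner ℝ d h - 4 * inner ℝ d f * inner ℝ b h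
          - inner ℝ (e * star d) (g * star b) + inner ℝ (e * star b) (g * star d)
          - inner ℝ (c * star f) (a * star h) + inner ℝ (a * star f) (c * star h)
          - inner ℝ (a * star d - c * star b) (g * star f - e * star h)) := by
  refine ⟨⟨OH2.finrank_octPlane, inferInstance, inferInstance, inferInstance,
    OH2.simplyConnectedSpace⟩, OH2.exists_riemannianMetric, OH2.isHomogeneousMetric,
    fun X Y Z W => ?_, fun a b c d e f g h => ?_⟩
  · rw [OH2.riemannCurvature_origin, OP2.riemannCurvature_basePoint]
  · exact OP2.riemannCurvature_basePoint (a, b) (c, d) (e, f) (g, h)
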